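/- Let $\mathfrak m$ be a finite-dimensional Lie algebra over a field $k$ of characteristic zero, and let $U(\mathfrak m)$ be its enveloping algebra with its standard Hopf algebra structure ($\Delta x=x\otimes 1+1\otimes x$, $\epsilon(x)=0$ for $x\in\mathfrak m$). A pre-Lie structure on $\mathfrak m$ is a bilinear product $\circ$ on $\mathfrak m$ with $$(x\circ y)\circ z-(y\circ x)\circ z=x\circ(y\circ z)-y\circ(x\circ z),\qquad [x,y]=x\circ y-y\circ x .$$ A bicovariant differential graded algebra on a Hopf algebra $H$ is an $\mathbb N$-graded algebra $\Omega=\bigoplus_{n\ge0}\Omega^n$ with $\Omega^0=H$ and a degree-one graded derivation $\mathrm d$ with $\mathrm d^2=0$, together with degree-preserving algebra maps $\Delta_L:\Omega\to H\otimes\Omega$ and $\Delta_R:\Omega\to\Omega\otimes H$ that make $\Omega$ an $H$-bicomodule, restrict to the coproduct on $H$ and commute with $\mathrm d$. It is standard if $\Omega$ is generated as an algebra by $H$ and $\mathrm dH$; it is connected if $\ker(\mathrm d:H\to\Omega^1)=k1$; its left-invariant $1$-forms are $\Lambda^1=\{\omega\in\Omega^1:\Delta_L\omega=1\otimes\omega\}$.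 Proposition. The following are equivalent: (a) $U(\mathfrak m)$ admits a connected bicovariant differential graded algebra with $\dim\Lambda^1=\dim\mathfrak m$; (b) $U(\mathfrak m)$ admits such a differential graded algebra which is moreover standard; (c) $\mathfrak m$ admits a pre-Lie structure. Moreover, the calculus is given by the relations $[x,\mathrm dy]=\mathrm d(x\circ y)$, in the following sense. For every pre-Lie structure $\circ$ on $\mathfrak m$ there is a standard connected bicovariant differential graded algebra on $U(\mathfrak m)$ with $\dim\Lambda^1=\dim\mathfrak m$ and $$x\,\mathrm dy-(\mathrm dy)\,x=\mathrm d(x\circ y)\qquad\text{for all }x,y\in\mathfrak m .$$ Conversely, for every connected bicovariant differential graded algebra on $U(\mathfrak m)$ with $\dim\Lambda^1=\dim\mathfrak m$, the map $U(\mathfrak m)\otimes\mathfrak m\to\Omega^1$, $a\otimes x\mapsto a\,\mathrm dx$, is bijective, and there is exactly one pre-Lie structure $\circ$ on $\mathfrak m$ for which these relations hold. -/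

import Mathlib

open scoped TensorProduct

universe u v w

section EnvelopingBialgebra

attribute [local instance 100] LieRing.ofAssociativeRing

variable (K : Type u) [CommRing K] (L : Type v) [LieRing L] [LieAlgebra K L]

namespace UniversalEnvelopingAlgebra

/-- The Lie algebra map `x ↦ x ⊗ 1 + 1 ⊗ x` from `L` to `U(L) ⊗ U(L)`. -/
def primitiveHom :
    L →ₗ⁅K⁆ (UniversalEnvelopingAlgebra K L ⊗[K] UniversalEnvelopingAlgebra K L) where
  toFun x := ι K x ⊗ₜ[K] 1 + 1 ⊗ₜ[K] ι K x
  map_add' x y := by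
    simp only [map_add, TensorProduct.add_tmul, TensorProduct.tmul_add]; abel
  map_smul' r x := by
    simp only [map_smul, TensorProduct.smul_tmul', TensorProduct.tmul_smul, smul_add,
      RingHom.id_apply]
  map_lie' {x y} := by
    simp only [LieHom.map_lie, LieRing.of_associative_ring_bracket, add_mul, mul_add,
      Algebra.TensorProduct.tmul_mul_tmul, mul_one, one_mul, TensorProduct.sub_tmul,
      TensorProduct.tmul_sub]
    abel

/-- The coproduct of `U(L)`: the algebra map with `Δ x = x ⊗ 1 + 1 ⊗ x` for `x ∈ L`. -/
def comulHom : UniversalEnvelopingAlgebra K L →ₐ[K]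
    UniversalEnvelopingAlgebra K L ⊗[K] UniversalEnvelopingAlgebra K L :=
  lift K (primitiveHom K L)

/-- The counit of `U(L)`: the algebra map with `ε x = 0` for `x ∈ L`. -/
def counitHom : UniversalEnvelopingAlgebra K L →ₐ[K] K :=
  lift K (0 : L →ₗ⁅K⁆ K)

theorem comulHom_ι (x : L) : comulHom K L (ι K x) = ι K x ⊗ₜ[K] 1 + 1 ⊗ₜ[K] ι K x :=
  lift_ι_apply K (primitiveHom K L) x

theorem counitHom_ι (x : L) : counitHom K L (ι K x) = 0 :=
  lift_ι_apply K (0 : L →ₗ⁅K⁆ K) x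

theorem algHom_eq_of_ι {A : Type w} [Ring A] [Algebra K A]
    {f g : UniversalEnvelopingAlgebra K L →ₐ[K] A} (h : ∀ x : L, f (ι K x) = g (ι K x)) : f = g :=
  hom_ext K (LieHom.ext h)

/-- The standard bialgebra structure of `U(L)`, underlying its standard Hopf algebra structure. -/
noncomputable instance instBialgebraEnveloping : Bialgebra K (UniversalEnvelopingAlgebra K L) :=
  Bialgebra.ofAlgHom (comulHom K L) (counitHom K L)
    (by
      refine algHom_eq_of_ι K L fun x => ?_
      simp only [AlgHom.coe_comp, Function.comp_apply, comulHom_ι, map_add,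
        Algebra.TensorProduct.map_tmul, AlgHom.coe_id, id_eq, map_one,
        TensorProduct.add_tmul, TensorProduct.tmul_add, AlgEquiv.toAlgHom_apply,
        Algebra.TensorProduct.assoc_tmul, Algebra.TensorProduct.one_def]
      abel)
    (by
      refine algHom_eq_of_ι K L fun x => ?_
      simp [-ι_apply, comulHom_ι, counitHom_ι])
    (by
      refine algHom_eq_of_ι K L fun x => ?_
      simp [-ι_apply, comulHom_ι, counitHom_ι])

end UniversalEnvelopingAlgebra

end EnvelopingBialgebra

/-- A (left) pre-Lie structure on the Lie algebra `L`: a bilinear product `x ∘ y = mul x y`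
satisfying the left pre-Lie identity, whose commutator is the given Lie bracket of `L`. -/
@[ext]
structure PreLieStructure (K : Type u) (L : Type v) [CommRing K] [LieRing L] [LieAlgebra K L] where
  mul : L →ₗ[K] L →ₗ[K] L
  left_symm : ∀ x y z : L,
    mul (mul x y) z - mul (mul y x) z = mul x (mul y z) - mul y (mul x z)
  lie_eq : ∀ x y : L, ⁅x, y⁆ = mul x y - mul y x

/-- A differential graded algebra over the algebra `A` with total space `Ω`: an `ℕ`-graded algebra
`Ω = ⨁ Ωⁿ` with `Ω⁰ = A` (through `incl`) and a differential `d` of degree one which squares to zero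
and is a graded derivation. -/
structure DiffGradedAlgebra (K : Type u) (A : Type v) (Ω : Type w) [CommRing K]
    [Ring A] [Algebra K A] [Ring Ω] [Algebra K Ω] where
  /-- the homogeneous parts `Ωⁿ` -/
  deg : ℕ → Submodule K Ω
  graded : GradedAlgebra deg
  incl : A →ₐ[K] Ω
  incl_injective : Function.Injective incl
  range_incl : LinearMap.range incl.toLinearMap = deg 0
  d : Ω →ₗ[K] Ω
  d_mem : ∀ (n : ℕ) (ω : Ω), ω ∈ deg n → d ω ∈ deg (n + 1)
  d_d : ∀ ω : Ω, d (d ω) = 0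
  leibniz : ∀ (n : ℕ) (ω η : Ω), ω ∈ deg n →
    d (ω * η) = d ω * η + (-1 : Ω) ^ n * (ω * d η)

/-- The differential graded algebra is standard (a differential exterior algebra): `Ω` is generated
as an algebra by `A` and `dA`. -/
def DiffGradedAlgebra.IsStandard {K : Type u} {A : Type v} {Ω : Type w} [CommRing K]
    [Ring A] [Algebra K A] [Ring Ω] [Algebra K Ω] (C : DiffGradedAlgebra K A Ω) : Prop :=
  Algebra.adjoin K (Set.range C.incl ∪ Set.range (fun a : A => C.d (C.incl a))) = ⊤

/-- A bicovariant differential graded algebra over `H`: a differential graded algebra over `H`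
with a left coaction `Δ_L : Ω → H ⊗ Ω` and a right coaction `Δ_R : Ω → Ω ⊗ H` which are degree
preserving algebra maps, extend the coproduct of `H = Ω⁰`, commute with `d`, and make `Ω` an
`H`-bicomodule. -/
structure BicovariantDGA (K : Type u) (H : Type v) (Ω : Type w) [CommRing K]
    [Ring H] [Bialgebra K H] [Ring Ω] [Algebra K Ω] extends DiffGradedAlgebra K H Ω where
  coactL : Ω →ₐ[K] H ⊗[K] Ω
  coactR : Ω →ₐ[K] Ω ⊗[K] H
  coactL_incl : ∀ a : H,
    coactL (incl a) = TensorProduct.map LinearMap.id incl.toLinearMap (Coalgebra.comul (R := K) a)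
  coactR_incl : ∀ a : H,
    coactR (incl a) = TensorProduct.map incl.toLinearMap LinearMap.id (Coalgebra.comul (R := K) a)
  coactL_d : ∀ ω : Ω, coactL (d ω) = TensorProduct.map LinearMap.id d (coactL ω)
  coactR_d : ∀ ω : Ω, coactR (d ω) = TensorProduct.map d LinearMap.id (coactR ω)
  coactL_deg : ∀ (n : ℕ) (ω : Ω), ω ∈ deg n →
    coactL ω ∈ LinearMap.range (TensorProduct.map (LinearMap.id : H →ₗ[K] H) (deg n).subtype)
  coactR_deg : ∀ (n : ℕ) (ω : Ω), ω ∈ deg n →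
    coactR ω ∈ LinearMap.range (TensorProduct.map (deg n).subtype (LinearMap.id : H →ₗ[K] H))
  coactL_coassoc : ∀ ω : Ω,
    TensorProduct.assoc K H H Ω
        (TensorProduct.map (Coalgebra.comul (R := K) (A := H)) LinearMap.id (coactL ω)) =
      TensorProduct.map LinearMap.id coactL.toLinearMap (coactL ω)
  coactR_coassoc : ∀ ω : Ω,
    TensorProduct.assoc K Ω H H
        (TensorProduct.map coactR.toLinearMap LinearMap.id (coactR ω)) =
      TensorProduct.map LinearMap.id (Coalgebra.comul (R := K) (A := H)) (coactR ω)
  coactL_counit : ∀ ω : Ω,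
    TensorProduct.lid K Ω
      (TensorProduct.map (Coalgebra.counit (R := K) (A := H)) LinearMap.id (coactL ω)) = ω
  coactR_counit : ∀ ω : Ω,
    TensorProduct.rid K Ω
      (TensorProduct.map LinearMap.id (Coalgebra.counit (R := K) (A := H)) (coactR ω)) = ω
  bicomodule : ∀ ω : Ω,
    TensorProduct.assoc K H Ω H
        (TensorProduct.map coactL.toLinearMap LinearMap.id (coactR ω)) =
      TensorProduct.map LinearMap.id coactR.toLinearMap (coactL ω)

namespace BicovariantDGA

variable {K : Type u} {H : Type v} {Ω : Type w} [CommRing K] [Ring H] [Bialgebra K H]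
  [Ring Ω] [Algebra K Ω]

/-- Connectedness: the kernel of `d : Ω⁰ = H → Ω¹` is `K 1`. -/
def IsConnected (C : BicovariantDGA K H Ω) : Prop :=
  ∀ a : H, C.d (C.incl a) = 0 ↔ ∃ r : K, a = algebraMap K H r

/-- The space `Λ¹` of left-invariant `1`-forms: `ω ∈ Ω¹` with `Δ_L ω = 1 ⊗ ω`. -/
def leftInvariantOneForms (C : BicovariantDGA K H Ω) : Submodule K Ω :=
  C.deg 1 ⊓ LinearMap.eqLocus C.coactL.toLinearMap (TensorProduct.mk K H Ω 1)

end BicovariantDGA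

/-- A bicovariant differential graded algebra over `U(L)` which is connected and of classical
dimension, i.e. `Λ¹` is finite dimensional with `dim Λ¹ = dim L`. -/
def IsConnectedClassical {K : Type u} {L : Type v} {Ω : Type w} [Field K] [LieRing L]
    [LieAlgebra K L] [Ring Ω] [Algebra K Ω]
    (C : BicovariantDGA K (UniversalEnvelopingAlgebra K L) Ω) : Prop :=
  C.IsConnected ∧ Module.Finite K C.leftInvariantOneForms ∧
    Module.finrank K C.leftInvariantOneForms = Module.finrank K L

section EnvelopingCalculus

attribute [local instance 100] LieRing.ofAssociativeRing

variable {K : Type u} {L : Type v} {Ω : Type w} [Field K] [LieRing L]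
    [LieAlgebra K L] [Ring Ω] [Algebra K Ω]

/-- The element of `Ω⁰` given by `x ∈ L ⊆ U(L)`. -/
noncomputable def DiffGradedAlgebra.gen
    (C : DiffGradedAlgebra K (UniversalEnvelopingAlgebra K L) Ω) : L →ₗ[K] Ω :=
  C.incl.toLinearMap ∘ₗ
    (UniversalEnvelopingAlgebra.ι K (L := L)).toLinearMap

/-- The linear map `U(L) ⊗ L → Ω`, `a ⊗ x ↦ a dx`. -/
noncomputable def DiffGradedAlgebra.formMap
    (C : DiffGradedAlgebra K (UniversalEnvelopingAlgebra K L) Ω) :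
    UniversalEnvelopingAlgebra K L ⊗[K] L →ₗ[K] Ω :=
  TensorProduct.lift ((LinearMap.mul K Ω).compl₁₂ C.incl.toLinearMap (C.d ∘ₗ C.gen))

/-- The relations `[x, dy] = x dy - dy x = d(x ∘ y)` for `x, y ∈ L`. -/
def SatisfiesPreLieRelations (C : DiffGradedAlgebra K (UniversalEnvelopingAlgebra K L) Ω)
    (P : PreLieStructure K L) : Prop :=
  ∀ x y : L, C.gen x * C.d (C.gen y) - C.d (C.gen y) * C.gen x = C.d (C.gen (P.mul x y))

end EnvelopingCalculus

/-!
A connected bicovariant calculus of classical dimension on `U(L)` and a pre-Lie structure on `L`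
determine each other through `[x, dy] = d(x ∘ y)`.

*From a calculus to a pre-Lie structure.* The forms `dx` with `x ∈ L` are left-invariant because `x`
is primitive. If `dx = 0`, then connectedness and the counit give `x = 0` in `U(L)`, so `x = 0` by
the injectivity of `L → U(L)` (`PBW.ι_injective`, proved by straightening words with the diamond
lemma). By the assumption on dimensions, `d` identifies `L` with the left-invariant `1`-forms
(`BicovariantDGA.exists_d_gen_eq`). The structure theorem for Hopf modules, with the projection
`ω ↦ S(ω₋₁) ω₀` onto left-invariant forms, shows that `Ω¹` is freely generated over `U(L)` by these
forms (`BicovariantDGA.formMap_injective`, `BicovariantDGA.range_formMap`). The commutator `[x, dy]`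
is again left-invariant, hence equal to `d(x ∘ y)` for a unique `x ∘ y`; the pre-Lie identity is the
Jacobi identity for these commutators, and differentiating `x y - y x = [x, y]` gives
`x ∘ y - y ∘ x = [x, y]` (`BicovariantDGA.existsUnique_preLieStructure`).

*From a pre-Lie structure to a calculus.* The algebra `PreLieStructure.Forms` is generated by `L`
and a copy `dL` of it, with the relations of `U(L)`, `[x, dy] = d(x ∘ y)` and `dx dy + dy dx = 0`. The
differential, the grading and the coactions come from its universal property; the differential and
the grading are encoded as algebra maps into triangular matrices and into polynomials. That no
relations are lost is seen on a representation on `U(L) ⊕ (L ⊗ U(L))`, in which `da` acts by a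
derivation `U(L) → L ⊗ U(L)`. It shows that the left-invariant forms are exactly `dL`
(`PreLieStructure.Forms.leftInvariantOneForms_eq`). For connectedness, the contraction
`L ⊗ U(L) → U(L)`, applied to `da` for a product `a` of `n` elements of `L`, gives `n a` up to
shorter products (`PreLieStructure.Forms.contract_dFn`), as for the Euler vector field on
polynomials; in characteristic zero, `da = 0` therefore forces `a` to be a scalar.
-/

/-! ### Injectivity of the map from a Lie algebra to its enveloping algebra -/

namespace PBW

section Words

variable {K : Type*} [CommRing K] {L : Type*} [LieRing L] [LieAlgebra K L]
  {I : Type*} (b : Module.Basis I K L)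
  {N : Type*} [AddCommGroup N] [Module K N]

/-- The function `φ` on words in the basis vectors, extended linearly in one letter: that is, the
value of `φ` at `u x v` for words `u`, `v` and an arbitrary vector `x`. -/
noncomputable def insert (φ : List I → N) (u v : List I) : L →ₗ[K] N :=
  b.constr K fun c => φ (u ++ c :: v)

@[simp]
theorem insert_basis (φ : List I → N) (u v : List I) (c : I) :
    insert b φ u v (b c) = φ (u ++ c :: v) := by
  simp [insert]

/-- `φ` respects the defining relations `x y - y x = [x, y]` of the enveloping algebra on words of
length at most `n`. -/
def RespectsBracket (n : ℕ) (φ : List I → N) : Prop :=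
  ∀ u i j v, u.length + v.length + 2 ≤ n →
    φ (u ++ i :: j :: v) - φ (u ++ j :: i :: v) = insert b φ u v ⁅b i, b j⁆

variable {b}

/-- The defining relation with one of the basis vectors replaced by an arbitrary vector. -/
theorem RespectsBracket.insert_sub {n : ℕ} {φ : List I → N} (h : RespectsBracket b n φ)
    (u v : List I) (k : I) (x : L) (hn : u.length + v.length + 2 ≤ n) :
    insert b φ u (k :: v) x - insert b φ (u ++ [k]) v x = insert b φ u v ⁅x, b k⁆ := by
  have : insert b φ u (k :: v) - insert b φ (u ++ [k]) v =
      -(insert b φ u v ∘ₗ LieAlgebra.ad K L (b k)) := by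
    refine b.ext fun c => ?_
    have := h u c k v hn
    rw [← lie_skew, map_neg] at this
    simpa using this
  rw [← lie_skew, map_neg]
  simpa using LinearMap.congr_fun this x

theorem RespectsBracket.insert_swap_left {n : ℕ} {φ : List I → N} (h : RespectsBracket b n φ)
    (u m v : List I) (k l : I) (x : L) (hn : u.length + m.length + v.length + 3 ≤ n) :
    insert b φ u (m ++ k :: l :: v) x - insert b φ u (m ++ l :: k :: v) x =
      b.constr K (fun c => insert b φ (u ++ c :: m) v ⁅b k, b l⁆) x := by
  rw [← LinearMap.sub_apply]
  refine LinearMap.congr_fun (b.ext fun c => ?_) x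
  have := h (u ++ c :: m) k l v (by simp; omega)
  simpa using this

theorem RespectsBracket.insert_swap_right {n : ℕ} {φ : List I → N} (h : RespectsBracket b n φ)
    (u m v : List I) (i j : I) (y : L) (hn : u.length + m.length + v.length + 3 ≤ n) :
    insert b φ (u ++ i :: j :: m) v y - insert b φ (u ++ j :: i :: m) v y =
      b.constr K (fun c => insert b φ u (m ++ c :: v) ⁅b i, b j⁆) y := by
  rw [← LinearMap.sub_apply]
  refine LinearMap.congr_fun (b.ext fun c => ?_) y
  have := h u i j (m ++ c :: v) (by simp; omega)
  simpa using this

theorem constr_insert_comm (φ : List I → N) (u m v : List I) (x y : L) :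
    b.constr K (fun c => insert b φ (u ++ c :: m) v y) x =
      b.constr K (fun c => insert b φ u (m ++ c :: v) x) y := by
  rw [Module.Basis.constr_apply, Module.Basis.constr_apply]
  simp only [insert, Module.Basis.constr_apply, Finsupp.sum, Finset.smul_sum, smul_smul]
  rw [Finset.sum_comm]
  simp [mul_comm]

variable [LinearOrder I]

/-- The number of inversions of a word. -/
def inversions : List I → ℕ
  | [] => 0
  | a :: w => w.countP (· < a) + inversions w

theorem inversions_swap_lt (u v : List I) {i j : I} (h : j < i) :
    inversions (u ++ j :: i :: v) < inversions (u ++ i :: j :: v) := by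
  induction u with
  | nil => simp [inversions, h, not_lt.mpr h.le]; omega
  | cons a u ih =>
    have : (u ++ j :: i :: v).countP (· < a) = (u ++ i :: j :: v).countP (· < a) :=
      List.Perm.countP_eq _ (List.Perm.append_left _ (List.Perm.swap _ _ _))
    simp only [List.cons_append, inversions, this]
    omega

variable (b) in
open Classical in
/-- Straightening of a word: as long as the word has a descent, exchange the two letters and add the
value of `φ` at the shorter word in which they are replaced by their bracket. -/
noncomputable def straighten (φ : List I → N) (w : List I) : N :=
  if h : ∃ t : List I × I × I × List I,
      w = t.1 ++ t.2.1 :: t.2.2.1 :: t.2.2.2 ∧ t.2.2.1 < t.2.1 then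
    insert b φ h.choose.1 h.choose.2.2.2 ⁅b h.choose.2.1, b h.choose.2.2.1⁆ +
      straighten φ (h.choose.1 ++ h.choose.2.2.1 :: h.choose.2.1 :: h.choose.2.2.2)
  else 0
termination_by inversions w
decreasing_by
  conv_rhs => rw [h.choose_spec.1]
  exact inversions_swap_lt _ _ h.choose_spec.2

/-- Two straightening steps at descents of the same word, the first one to the left of the second,
have the same result, provided straightening is independent of the choice of the descents for all
words with fewer inversions. This is the diamond lemma: overlapping descents are resolved by the
Jacobi identity. -/
theorem straighten_diamond {n : ℕ} {φ : List I → N} (h : RespectsBracket b n φ) (w : List I)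
    (hw : w.length ≤ n + 1)
    (ih : ∀ u i j v, inversions (u ++ i :: j :: v) < inversions w →
      (u ++ i :: j :: v).length ≤ n + 1 → j < i →
      straighten b φ (u ++ i :: j :: v) =
        insert b φ u v ⁅b i, b j⁆ + straighten b φ (u ++ j :: i :: v))
    {u v u' v' : List I} {i j i' j' : I} (e : w = u ++ i :: j :: v) (e' : w = u' ++ i' :: j' :: v')
    (hij : j < i) (hij' : j' < i') (hl : u.length ≤ u'.length) :
    insert b φ u v ⁅b i, b j⁆ + straighten b φ (u ++ j :: i :: v) =
      insert b φ u' v' ⁅b i', b j'⁆ + straighten b φ (u' ++ j' :: i' :: v') := by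
  obtain ⟨s, rfl⟩ : ∃ s, u' = u ++ s := by
    have : u <+: u' := List.prefix_of_prefix_length_le ⟨_, e.symm⟩ ⟨_, e'.symm⟩ hl
    obtain ⟨s, hs⟩ := this
    exact ⟨s, hs.symm⟩
  have h1 : inversions (u ++ j :: i :: v) < inversions w := e ▸ inversions_swap_lt u v hij
  have h2 : inversions (u ++ s ++ j' :: i' :: v') < inversions w :=
    e' ▸ inversions_swap_lt (u ++ s) v' hij'
  rw [e, List.append_assoc, List.append_cancel_left_eq] at e'
  -- the two descents coincide, overlap in one letter, or are disjoint
  rcases s with _ | ⟨a, _ | ⟨a', m⟩⟩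
  · simp only [List.nil_append, List.cons.injEq] at e'
    obtain ⟨rfl, rfl, rfl⟩ := e'
    simp
  · simp only [List.cons_append, List.nil_append, List.cons.injEq] at e'
    obtain ⟨rfl, rfl, rfl⟩ := e'
    have hlen : (u ++ i :: j :: j' :: v').length ≤ n + 1 := e ▸ hw
    simp only [List.length_append, List.length_cons] at hlen
    -- both sides are straightened down to `u ++ j' :: j :: i :: v'`
    have hik := hij'.trans hij
    have s1 := ih (u ++ [j]) i j' v' (by simpa using h1) (by simp; omega) hik
    have h1' := inversions_swap_lt (u ++ [j]) v' hik
    have s2 := ih u j j' (i :: v') (by simpa using (by simpa using h1' : _ < _).trans h1)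
      (by simp; omega) hij'
    have s3 := ih u i j' (j :: v') (by simpa using h2) (by simp; omega) hik
    have h2' := inversions_swap_lt u (j :: v') hik
    have s4 := ih (u ++ [j']) i j v' (by simpa using h2'.trans (by simpa using h2))
      (by simp; omega) hij
    simp only [List.append_assoc, List.cons_append, List.nil_append] at s1 s2 s3 s4 ⊢
    rw [s1, s2, s3, s4]
    have r1 := h.insert_sub u v' j' ⁅b i, b j⁆ (by omega)
    have r2 := h.insert_sub u v' j ⁅b i, b j'⁆ (by omega)
    have r3 := h.insert_sub u v' i ⁅b j, b j'⁆ (by omega)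
    have jac : insert b φ u v' ⁅⁅b i, b j⁆, b j'⁆ - insert b φ u v' ⁅⁅b i, b j'⁆, b j⁆ +
        insert b φ u v' ⁅⁅b j, b j'⁆, b i⁆ = 0 := by
      rw [← map_sub, ← map_add]
      convert map_zero (insert b φ u v')
      rw [← lie_skew ⁅b j, b j'⁆ (b i), ← lie_skew ⁅b i, b j'⁆ (b j),
        leibniz_lie (b i) (b j) (b j')]
      abel
    rw [← sub_eq_zero, ← jac, ← r1, ← r2, ← r3]
    abel
  · simp only [List.cons_append, List.cons.injEq] at e'
    obtain ⟨rfl, rfl, rfl⟩ := e'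
    have hlen := e ▸ hw
    simp only [List.length_append, List.length_cons] at hlen
    -- both sides are straightened down to `u ++ j :: i :: m ++ j' :: i' :: v'`
    have s1 := ih (u ++ j :: i :: m) i' j' v' (by simpa using h1) (by simp; omega) hij'
    have s2 := ih u i j (m ++ j' :: i' :: v') (by simpa using h2) (by simp; omega) hij
    simp only [List.append_assoc, List.cons_append] at s1 s2 ⊢
    rw [s1, s2]
    have r1 := h.insert_swap_left u m v' i' j' ⁅b i, b j⁆ (by omega)
    have r2 := h.insert_swap_right u m v' i j ⁅b i', b j'⁆ (by omega)
    rw [constr_insert_comm] at r1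
    rw [← r2] at r1
    rw [← sub_eq_zero, ← sub_eq_zero.mpr r1]
    abel

/-- Straightening does not depend on the choice of the descent. -/
theorem straighten_eq {n : ℕ} {φ : List I → N} (h : RespectsBracket b n φ) (u v : List I) (i j : I)
    (hw : (u ++ i :: j :: v).length ≤ n + 1) (hij : j < i) :
    straighten b φ (u ++ i :: j :: v) =
      insert b φ u v ⁅b i, b j⁆ + straighten b φ (u ++ j :: i :: v) := by
  generalize hm : inversions (u ++ i :: j :: v) = m
  induction m using Nat.strong_induction_on generalizing u v i j with
  | _ m ih =>
  subst hm
  have hex : ∃ t : List I × I × I × List I,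
      u ++ i :: j :: v = t.1 ++ t.2.1 :: t.2.2.1 :: t.2.2.2 ∧ t.2.2.1 < t.2.1 :=
    ⟨(u, i, j, v), rfl, hij⟩
  have ih' : ∀ u₁ i₁ j₁ v₁, inversions (u₁ ++ i₁ :: j₁ :: v₁) < inversions (u ++ i :: j :: v) →
      (u₁ ++ i₁ :: j₁ :: v₁).length ≤ n + 1 → j₁ < i₁ →
      straighten b φ (u₁ ++ i₁ :: j₁ :: v₁) =
        insert b φ u₁ v₁ ⁅b i₁, b j₁⁆ + straighten b φ (u₁ ++ j₁ :: i₁ :: v₁) :=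
    fun u₁ i₁ j₁ v₁ hlt hlen hij₁ => ih _ hlt u₁ v₁ i₁ j₁ hlen hij₁ rfl
  conv_lhs => rw [straighten, dif_pos hex]
  obtain ⟨e, hlt⟩ := hex.choose_spec
  rcases le_total u.length hex.choose.1.length with hl | hl
  · exact (straighten_diamond h _ hw ih' rfl e hij hlt hl).symm
  · exact straighten_diamond h _ hw ih' e rfl hlt hij hl

theorem straighten_sub {n : ℕ} {φ : List I → N} (h : RespectsBracket b n φ) (u v : List I) (i j : I)
    (hw : (u ++ i :: j :: v).length ≤ n + 1) :
    straighten b φ (u ++ i :: j :: v) - straighten b φ (u ++ j :: i :: v) =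
      insert b φ u v ⁅b i, b j⁆ := by
  rcases lt_trichotomy i j with hij | rfl | hij
  · rw [straighten_eq h u v j i (by simpa using hw) hij, ← lie_skew (b i) (b j), map_neg]
    abel
  · simp
  · rw [straighten_eq h u v i j hw hij]
    abel

variable (b) in
/-- Approximations to a function on words which respects all brackets and sends the one-letter word
`i` to `b i`; the `n`-th one is correct on words of length at most `n + 1`. -/
noncomputable def approx : ℕ → List I → L
  | 0, w => (w.head?.map b).getD 0
  | n + 1, w => if w.length ≤ n + 1 then approx n w else straighten b (approx n) w

omit [LinearOrder I] in
theorem insert_congr {φ ψ : List I → N} {u v : List I}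
    (h : ∀ c, φ (u ++ c :: v) = ψ (u ++ c :: v)) : insert b φ u v = insert b ψ u v := by
  simp [insert, h]

theorem respectsBracket_approx (n : ℕ) : RespectsBracket b (n + 1) (approx b n) := by
  induction n with
  | zero => intro u i j v h; omega
  | succ n ih =>
    intro u i j v h
    have e : insert b (approx b (n + 1)) u v = insert b (approx b n) u v :=
      insert_congr fun c => by simp only [approx]; rw [if_pos (by simp; omega)]
    rw [e]
    by_cases hn : u.length + v.length + 2 ≤ n + 1
    · rw [← ih u i j v hn]
      simp only [approx]
      rw [if_pos (by simp; omega), if_pos (by simp; omega)]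
    · rw [← straighten_sub ih u v i j (by simp; omega)]
      simp only [approx]
      rw [if_neg (by simp; omega), if_neg (by simp; omega)]

theorem approx_eq {n : ℕ} {w : List I} (h : w.length ≤ n + 1) :
    approx b n w = approx b w.length w := by
  have key : ∀ m k, w.length ≤ m + 1 → approx b (m + k) w = approx b m w := by
    intro m k hm
    induction k with
    | zero => rfl
    | succ k ih => rw [← add_assoc, approx, if_pos (by omega), ih]
  rcases le_total w.length n with hn | hn
  · obtain ⟨k, rfl⟩ := Nat.exists_eq_add_of_le hn
    exact key _ k (by omega)
  · obtain ⟨k, hk⟩ := Nat.exists_eq_add_of_le hn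
    conv_rhs => rw [hk]
    exact (key n k h).symm

variable (b) in
/-- There is a function on words which respects all brackets and is the identity on letters. -/
theorem exists_respectsBracket :
    ∃ φ : List I → L, (∀ n, RespectsBracket b n φ) ∧ ∀ i, φ [i] = b i := by
  refine ⟨fun w => approx b w.length w, fun n u i j v _ => ?_, fun i => ?_⟩
  · have h := respectsBracket_approx (b := b) (u.length + v.length + 1) u i j v (by omega)
    rw [approx_eq (w := u ++ i :: j :: v) (by simp; omega),
      approx_eq (w := u ++ j :: i :: v) (by simp; omega)] at h
    refine h.trans ?_
    exact LinearMap.congr_fun (insert_congr fun c => approx_eq (by simp; omega)) _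
  · have := approx_eq (b := b) (n := 0) (w := [i]) (by simp)
    exact this.symm.trans (by simp [approx])

end Words

section

attribute [local instance 100] LieRing.ofAssociativeRing

variable {K : Type*} [CommRing K] {L : Type*} [LieRing L] [LieAlgebra K L]
  {I : Type*} (b : Module.Basis I K L)
  (N : Type*) [AddCommGroup N] [Module K N]

/-- The functions on words which respect all brackets. -/
noncomputable def bracketFunctions : Submodule K (List I → N) where
  carrier := {φ | ∀ u i j v,
    φ (u ++ i :: j :: v) - φ (u ++ j :: i :: v) = insert b φ u v ⁅b i, b j⁆}
  add_mem' {φ ψ} hφ hψ u i j v := by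
    have : insert b (φ + ψ) u v = insert b φ u v + insert b ψ u v := b.ext fun c => by simp
    rw [this, LinearMap.add_apply, ← hφ, ← hψ, Pi.add_apply, Pi.add_apply]
    abel
  zero_mem' u i j v := by
    have : insert b (0 : List I → N) u v = 0 := b.ext fun c => by simp
    simp [this]
  smul_mem' r φ hφ u i j v := by
    have : insert b (r • φ) u v = r • insert b φ u v := b.ext fun c => by simp
    rw [this, LinearMap.smul_apply, ← hφ, Pi.smul_apply, Pi.smul_apply, smul_sub]

/-- Translation of functions on words: the vector `x` acts by `φ ↦ (w ↦ φ (w x))`. -/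
noncomputable def translate : L →ₗ[K] Module.End K (List I → N) :=
  b.constr K fun c =>
    { toFun := fun φ w => φ (w ++ [c]), map_add' := fun _ _ => rfl, map_smul' := fun _ _ => rfl }

variable {N}

theorem translate_apply (x : L) (φ : List I → N) (w : List I) :
    translate b N x φ w = insert b φ w [] x := by
  refine LinearMap.congr_fun (f := LinearMap.proj w ∘ₗ
    LinearMap.applyₗ φ ∘ₗ translate b N) (b.ext fun c => ?_) x
  simp [translate]

theorem translate_mem (x : L) {φ : List I → N} (h : φ ∈ bracketFunctions b N) :
    translate b N x φ ∈ bracketFunctions b N := by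
  have : translate b N x φ ∈ Submodule.span K (Set.range fun c => translate b N (b c) φ) := by
    have hx : x ∈ Submodule.span K (Set.range b) := b.mem_span x
    have := Submodule.mem_map_of_mem (f := LinearMap.applyₗ φ ∘ₗ translate b N) hx
    rwa [Submodule.map_span, ← Set.range_comp] at this
  refine Submodule.span_le.mpr ?_ this
  rintro _ ⟨c, rfl⟩ u i j v
  have e : insert b (translate b N (b c) φ) u v = insert b φ u (v ++ [c]) :=
    b.ext fun k => by simp [translate_apply]
  rw [e, ← h]
  simp [translate_apply]

/-- The action of `L` by translations on the functions which respect brackets. -/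
noncomputable def translateHom : L →ₗ⁅K⁆ Module.End K (bracketFunctions b N) where
  toFun x := (translate b N x).restrict fun _ => translate_mem b x
  map_add' x y := by ext; simp
  map_smul' r x := by ext; simp
  map_lie' {x y} := by
    ext ⟨φ, hφ⟩ w
    simp only [LieRing.of_associative_ring_bracket, LinearMap.sub_apply, Module.End.mul_apply,
      LinearMap.coe_restrict_apply, AddSubgroupClass.coe_sub, Pi.sub_apply]
    -- both sides are bilinear in `x` and `y`
    let f : L →ₗ[K] L →ₗ[K] N := (LieAlgebra.ad K L).toLinearMap.compr₂ (insert b φ w [])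
    let T : L →ₗ[K] L →ₗ[K] Module.End K (List I → N) :=
      (LinearMap.mul K (Module.End K (List I → N))).compl₁₂ (translate b N) (translate b N)
    let ev : Module.End K (List I → N) →ₗ[K] N := LinearMap.proj w ∘ₗ LinearMap.applyₗ φ
    have : f = T.compr₂ ev - T.flip.compr₂ ev := by
      refine b.ext fun i => b.ext fun j => ?_
      have := hφ w i j []
      simp [f, T, ev, translate_apply, ← this]
    have := LinearMap.congr_fun₂ this x y
    simpa [f, T, ev, translate_apply] using this

end

section

attribute [local instance 100] LieRing.ofAssociativeRing

/-- The part of the Poincaré–Birkhoff–Witt theorem that a Lie algebra which is free as a module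
embeds into its enveloping algebra. -/
theorem ι_injective (K : Type*) [CommRing K] (L : Type*) [LieRing L] [LieAlgebra K L]
    [Module.Free K L] : Function.Injective (UniversalEnvelopingAlgebra.ι K (L := L)) := by
  rw [injective_iff_map_eq_zero]
  intro x hx
  let b := Module.Free.chooseBasis K L
  classical
  let : LinearOrder (Module.Free.ChooseBasisIndex K L) := linearOrderOfSTO WellOrderingRel
  obtain ⟨φ, hφ, hb⟩ := exists_respectsBracket b
  have h0 : translateHom b (N := L) x = 0 := by
    rw [← UniversalEnvelopingAlgebra.lift_ι_apply K (translateHom b) x, hx, map_zero]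
  have h1 : insert b φ [] [] x = 0 := by
    rw [← translate_apply]
    exact congrFun (congrArg Subtype.val (LinearMap.congr_fun h0
      ⟨φ, fun u i j v => hφ _ u i j v le_rfl⟩)) []
  have h2 : insert b φ [] [] = LinearMap.id := b.ext fun c => by simp [hb]
  rwa [h2] at h1

end

end PBW

/-! ### The enveloping algebra as a Hopf algebra -/

/-- If `s` generates the algebra `A`, then a subspace of `A` which contains `1` and is stable under
left multiplication by the elements of `s` is all of `A`. -/
theorem Submodule.eq_top_of_mul_mem {K A : Type*} [CommRing K] [Ring A] [Algebra K A] {s : Set A}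
    (hs : Algebra.adjoin K s = ⊤) (p : Submodule K A) (h1 : 1 ∈ p)
    (hmul : ∀ x ∈ s, ∀ a ∈ p, x * a ∈ p) : p = ⊤ := by
  rw [eq_top_iff, ← Algebra.top_toSubmodule, ← hs, Algebra.adjoin_eq_span, Submodule.span_le]
  intro a ha
  induction ha using Submonoid.closure_induction_left with
  | one => exact h1
  | mul_left x hx y _ ih => exact hmul x hx y ih

namespace UniversalEnvelopingAlgebra

attribute [local instance 100] LieRing.ofAssociativeRing

variable {K : Type u} [CommRing K] {L : Type v} [LieRing L] [LieAlgebra K L]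

theorem adjoin_range_ι :
    Algebra.adjoin K (Set.range (ι K : L → UniversalEnvelopingAlgebra K L)) = ⊤ := by
  let S := Algebra.adjoin K (Set.range (ι K : L → UniversalEnvelopingAlgebra K L))
  let f : L →ₗ⁅K⁆ S :=
    { toFun := fun x => ⟨ι K x, Algebra.subset_adjoin ⟨x, rfl⟩⟩
      map_add' := fun x y => Subtype.ext (by simp [-ι_apply])
      map_smul' := fun r x => Subtype.ext (by simp [-ι_apply])
      map_lie' := fun {x y} => Subtype.ext (by
        simp [-ι_apply, LieRing.of_associative_ring_bracket]) }
  have h : S.val.comp (lift K f) = AlgHom.id K _ := algHom_eq_of_ι K L fun x => by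
    rw [AlgHom.comp_apply, lift_ι_apply]
    rfl
  refine eq_top_iff.mpr fun a _ => ?_
  have := DFunLike.congr_fun h a
  rw [AlgHom.comp_apply, AlgHom.id_apply] at this
  exact this ▸ (lift K f a).2

/-- Two linear maps on `U(L)` agree if they agree at `1` and their agreement at `a` implies that
at `x a` for `x ∈ L`. -/
theorem linearMap_eq_of_ι_mul {M : Type*} [AddCommGroup M] [Module K M]
    {f g : UniversalEnvelopingAlgebra K L →ₗ[K] M} (h1 : f 1 = g 1)
    (hmul : ∀ x a, f a = g a → f (ι K x * a) = g (ι K x * a)) : f = g := by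
  rw [← LinearMap.eqLocus_eq_top]
  refine Submodule.eq_top_of_mul_mem adjoin_range_ι _ h1 ?_
  rintro _ ⟨x, rfl⟩ a ha
  exact hmul x a ha

theorem comul_ι_mul (x : L) (a : UniversalEnvelopingAlgebra K L) :
    Coalgebra.comul (R := K) (ι K x * a) =
      (ι K x ⊗ₜ[K] 1 + 1 ⊗ₜ[K] ι K x) * Coalgebra.comul (R := K) a := by
  rw [Bialgebra.comul_mul]
  congr 1
  exact comulHom_ι K L x

theorem counit_ι_mul (x : L) (a : UniversalEnvelopingAlgebra K L) :
    Coalgebra.counit (R := K) (ι K x * a) = 0 := by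
  rw [Bialgebra.counit_mul]
  convert zero_mul _
  exact counitHom_ι K L x

variable (K L) in
/-- The antipode of `U(L)` as an algebra map into the opposite algebra. -/
noncomputable def antipodeHom : UniversalEnvelopingAlgebra K L →ₐ[K]
    (UniversalEnvelopingAlgebra K L)ᵐᵒᵖ :=
  lift K
    { toFun := fun x => MulOpposite.op (-ι K x)
      map_add' := fun x y => by simp only [map_add, neg_add, MulOpposite.op_add]
      map_smul' := fun r x => by
        simp only [map_smul, MulOpposite.op_neg, MulOpposite.op_smul, smul_neg, RingHom.id_apply]
      map_lie' := fun {x y} => by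
        simp only [LieHom.map_lie, LieRing.of_associative_ring_bracket, ← MulOpposite.op_mul,
          ← MulOpposite.op_sub]
        congr 1
        noncomm_ring }

variable (K L) in
/-- The antipode of `U(L)`: the anti-automorphism with `x ↦ -x` for `x ∈ L`. -/
noncomputable def antipode : UniversalEnvelopingAlgebra K L →ₗ[K] UniversalEnvelopingAlgebra K L :=
  (MulOpposite.opLinearEquiv K).symm.toLinearMap ∘ₗ (antipodeHom K L).toLinearMap

theorem antipode_apply (a : UniversalEnvelopingAlgebra K L) :
    antipode K L a = (antipodeHom K L a).unop := rfl

theorem antipode_one : antipode K L 1 = 1 := by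
  simp [antipode_apply]

theorem antipode_ι_mul (x : L) (a : UniversalEnvelopingAlgebra K L) :
    antipode K L (ι K x * a) = -(antipode K L a * ι K x) := by
  rw [antipode_apply, map_mul, MulOpposite.unop_mul]
  have : antipodeHom K L (ι K x) = MulOpposite.op (-ι K x) := lift_ι_apply K _ x
  rw [this, MulOpposite.unop_op, mul_neg]
  rfl

theorem mul_antipode_left (a : UniversalEnvelopingAlgebra K L) :
    LinearMap.mul' K _ (TensorProduct.map (antipode K L) LinearMap.id
      (Coalgebra.comul (R := K) a)) =
      algebraMap K _ (Coalgebra.counit (R := K) a) := by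
  refine LinearMap.congr_fun (f := LinearMap.mul' K _ ∘ₗ
    TensorProduct.map (antipode K L) LinearMap.id ∘ₗ Coalgebra.comul)
    (g := Algebra.linearMap K _ ∘ₗ Coalgebra.counit) (linearMap_eq_of_ι_mul ?_ fun x a _ => ?_) a
  · simp [Algebra.TensorProduct.one_def, antipode_one]
  · simp only [LinearMap.comp_apply, comul_ι_mul, counit_ι_mul, map_zero]
    induction Coalgebra.comul (R := K) a using TensorProduct.induction_on with
    | zero => simp
    | add s t hs ht => rw [mul_add, map_add, map_add, hs, ht, add_zero]
    | tmul b c =>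
      simp only [add_mul, Algebra.TensorProduct.tmul_mul_tmul, one_mul, map_add,
        TensorProduct.map_tmul, antipode_ι_mul, LinearMap.id_apply, LinearMap.mul'_apply]
      noncomm_ring

theorem mul_antipode_right (a : UniversalEnvelopingAlgebra K L) :
    LinearMap.mul' K _ (TensorProduct.map LinearMap.id (antipode K L)
      (Coalgebra.comul (R := K) a)) =
      algebraMap K _ (Coalgebra.counit (R := K) a) := by
  refine LinearMap.congr_fun (f := LinearMap.mul' K _ ∘ₗ
    TensorProduct.map LinearMap.id (antipode K L) ∘ₗ Coalgebra.comul)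
    (g := Algebra.linearMap K _ ∘ₗ Coalgebra.counit) (linearMap_eq_of_ι_mul ?_ fun x a ih => ?_) a
  · simp [Algebra.TensorProduct.one_def, antipode_one]
  · simp only [LinearMap.comp_apply, comul_ι_mul, counit_ι_mul, map_zero] at ih ⊢
    have key : ∀ t, LinearMap.mul' K _ (TensorProduct.map LinearMap.id (antipode K L)
        ((ι K x ⊗ₜ[K] 1 + 1 ⊗ₜ[K] ι K x) * t)) =
        ι K x * LinearMap.mul' K _ (TensorProduct.map LinearMap.id (antipode K L) t) -
        LinearMap.mul' K _ (TensorProduct.map LinearMap.id (antipode K L) t) * ι K x := by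
      intro t
      induction t using TensorProduct.induction_on with
      | zero => simp
      | add s t hs ht =>
        rw [mul_add, map_add, map_add, hs, ht, map_add, map_add, mul_add, add_mul]
        abel
      | tmul b c =>
        simp only [add_mul, Algebra.TensorProduct.tmul_mul_tmul, one_mul, map_add,
          TensorProduct.map_tmul, antipode_ι_mul, LinearMap.id_apply, LinearMap.mul'_apply]
        noncomm_ring
    rw [key, ih, Algebra.linearMap_apply, Algebra.commutes, sub_self]

end UniversalEnvelopingAlgebra

/-! ### The structure of a connected calculus of classical dimension -/

section Structure

open UniversalEnvelopingAlgebra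

attribute [local instance 100] LieRing.ofAssociativeRing

variable {K : Type u} [Field K] {L : Type v} [LieRing L] [LieAlgebra K L] {Ω : Type w} [Ring Ω]
  [Algebra K Ω]

namespace DiffGradedAlgebra

variable (C : DiffGradedAlgebra K (UniversalEnvelopingAlgebra K L) Ω)

theorem incl_mem (a : UniversalEnvelopingAlgebra K L) : C.incl a ∈ C.deg 0 :=
  C.range_incl ▸ ⟨a, rfl⟩

theorem mul_mem_deg {m n : ℕ} {ω η : Ω} (hω : ω ∈ C.deg m) (hη : η ∈ C.deg n) :
    ω * η ∈ C.deg (m + n) :=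
  C.graded.toGradedMonoid.mul_mem hω hη

theorem incl_mul_mem (a : UniversalEnvelopingAlgebra K L) {n : ℕ} {ω : Ω} (h : ω ∈ C.deg n) :
    C.incl a * ω ∈ C.deg n := by
  simpa using C.mul_mem_deg (C.incl_mem a) h

theorem mul_incl_mem (a : UniversalEnvelopingAlgebra K L) {n : ℕ} {ω : Ω} (h : ω ∈ C.deg n) :
    ω * C.incl a ∈ C.deg n :=
  C.mul_mem_deg h (C.incl_mem a)

theorem d_one : C.d 1 = 0 := by
  have := C.leibniz 0 1 1 (by simpa using C.incl_mem 1)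
  simpa using this

theorem gen_apply (x : L) : C.gen x = C.incl (ι K x) := rfl

theorem d_gen_mem (x : L) : C.d (C.gen x) ∈ C.deg 1 := C.d_mem 0 _ (C.incl_mem _)

theorem gen_lie (x y : L) : C.gen ⁅x, y⁆ = C.gen x * C.gen y - C.gen y * C.gen x := by
  simp only [gen_apply, LieHom.map_lie, LieRing.of_associative_ring_bracket, map_sub, map_mul]

theorem d_gen_mul_gen (x y : L) :
    C.d (C.gen x * C.gen y) = C.d (C.gen x) * C.gen y + C.gen x * C.d (C.gen y) := by
  simpa using C.leibniz 0 (C.gen x) (C.gen y) (C.incl_mem _)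

theorem formMap_tmul (a : UniversalEnvelopingAlgebra K L) (x : L) :
    C.formMap (a ⊗ₜ[K] x) = C.incl a * C.d (C.gen x) := rfl

/-- The left action `a ⊗ ω ↦ a ω` of `U(L)` on `Ω`. -/
noncomputable def leftAct : UniversalEnvelopingAlgebra K L ⊗[K] Ω →ₗ[K] Ω :=
  TensorProduct.lift ((LinearMap.mul K Ω) ∘ₗ C.incl.toLinearMap)

@[simp]
theorem leftAct_tmul (a : UniversalEnvelopingAlgebra K L) (ω : Ω) :
    C.leftAct (a ⊗ₜ[K] ω) = C.incl a * ω := rfl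

end DiffGradedAlgebra

namespace BicovariantDGA

variable (C : BicovariantDGA K (UniversalEnvelopingAlgebra K L) Ω)

theorem coactL_gen (x : L) : C.coactL (C.gen x) = ι K x ⊗ₜ[K] 1 + 1 ⊗ₜ[K] C.gen x := by
  rw [DiffGradedAlgebra.gen_apply, C.coactL_incl]
  have : Coalgebra.comul (R := K) (ι K x) = ι K x ⊗ₜ[K] 1 + 1 ⊗ₜ[K] ι K x := comulHom_ι K L x
  rw [this]
  simp [-ι_apply]

theorem d_gen_mem_leftInvariant (x : L) : C.d (C.gen x) ∈ C.leftInvariantOneForms := by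
  refine ⟨C.d_gen_mem x, ?_⟩
  change C.coactL (C.d (C.gen x)) = 1 ⊗ₜ[K] C.d (C.gen x)
  rw [C.coactL_d, coactL_gen]
  simp [C.d_one]

/-- The projection `ω ↦ S(ω₋₁) ω₀` of `Ω` to its left-invariant part, where
`Δ_L ω = ω₋₁ ⊗ ω₀`. -/
noncomputable def proj : Ω →ₗ[K] Ω :=
  C.leftAct ∘ₗ TensorProduct.map (antipode K L) LinearMap.id ∘ₗ C.coactL.toLinearMap

theorem proj_apply (ω : Ω) :
    C.proj ω = C.leftAct (TensorProduct.map (antipode K L) LinearMap.id (C.coactL ω)) := rfl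

/-- The linear map `h ⊗ s ↦ Δ_L(S h) s`. -/
noncomputable def coactAntipode : UniversalEnvelopingAlgebra K L ⊗[K]
    (UniversalEnvelopingAlgebra K L ⊗[K] Ω) →ₗ[K] UniversalEnvelopingAlgebra K L ⊗[K] Ω :=
  TensorProduct.lift (LinearMap.mul K (UniversalEnvelopingAlgebra K L ⊗[K] Ω) ∘ₗ
    C.coactL.toLinearMap ∘ₗ C.incl.toLinearMap ∘ₗ antipode K L)

theorem coactAntipode_tmul (h : UniversalEnvelopingAlgebra K L)
    (s : UniversalEnvelopingAlgebra K L ⊗[K] Ω) :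
    C.coactAntipode (h ⊗ₜ[K] s) = C.coactL (C.incl (antipode K L h)) * s := rfl

/-- The identity `Δ_L(S h₁) (h₂ ⊗ η) = 1 ⊗ S(h) η`. -/
theorem coactAntipode_comul (h : UniversalEnvelopingAlgebra K L) (η : Ω) :
    C.coactAntipode (TensorProduct.assoc K _ _ _ (Coalgebra.comul (R := K) h ⊗ₜ[K] η)) =
      1 ⊗ₜ[K] (C.incl (antipode K L h) * η) := by
  let f : UniversalEnvelopingAlgebra K L →ₗ[K] Ω →ₗ[K] UniversalEnvelopingAlgebra K L ⊗[K] Ω :=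
    (TensorProduct.mk K (UniversalEnvelopingAlgebra K L ⊗[K] UniversalEnvelopingAlgebra K L)
      Ω).compr₂ (C.coactAntipode ∘ₗ (TensorProduct.assoc K _ _ _).toLinearMap) ∘ₗ Coalgebra.comul
  let g : UniversalEnvelopingAlgebra K L →ₗ[K] Ω →ₗ[K] UniversalEnvelopingAlgebra K L ⊗[K] Ω :=
    (LinearMap.mul K Ω).compr₂ (TensorProduct.mk K _ _ 1) ∘ₗ C.incl.toLinearMap ∘ₗ antipode K L
  suffices f = g from LinearMap.congr_fun₂ this h η
  refine linearMap_eq_of_ι_mul (LinearMap.ext fun η => ?_)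
    fun x a ih => LinearMap.ext fun η => ?_
  · simp [f, g, Algebra.TensorProduct.one_def, coactAntipode_tmul, antipode_one]
  · have key : ∀ q : UniversalEnvelopingAlgebra K L ⊗[K] UniversalEnvelopingAlgebra K L,
        C.coactAntipode (TensorProduct.assoc K _ _ _
          (((ι K x ⊗ₜ[K] 1 + 1 ⊗ₜ[K] ι K x) * q) ⊗ₜ[K] η)) =
        -C.coactAntipode (TensorProduct.assoc K _ _ _ (q ⊗ₜ[K] (C.gen x * η))) := by
      intro q
      induction q using TensorProduct.induction_on with
      | zero => simp
      | add s t hs ht =>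
        simp only [mul_add, TensorProduct.add_tmul, map_add, hs, ht]; abel
      | tmul b c =>
        simp only [add_mul, Algebra.TensorProduct.tmul_mul_tmul, one_mul, TensorProduct.add_tmul,
          map_add, TensorProduct.assoc_tmul, coactAntipode_tmul, antipode_ι_mul, map_neg, map_mul,
          ← DiffGradedAlgebra.gen_apply, coactL_gen, neg_mul, mul_assoc, mul_add]
        abel
    have ih' := LinearMap.congr_fun ih (C.gen x * η)
    change C.coactAntipode (TensorProduct.assoc K _ _ _
      (Coalgebra.comul (R := K) a ⊗ₜ[K] (C.gen x * η))) =
      1 ⊗ₜ[K] (C.incl (antipode K L a) * (C.gen x * η)) at ih'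
    change C.coactAntipode (TensorProduct.assoc K _ _ _
      (Coalgebra.comul (R := K) (ι K x * a) ⊗ₜ[K] η)) =
      1 ⊗ₜ[K] (C.incl (antipode K L (ι K x * a)) * η)
    rw [comul_ι_mul, key, ih', antipode_ι_mul, map_neg, map_mul, neg_mul, TensorProduct.tmul_neg,
      mul_assoc]
    rfl

theorem coactL_proj (ω : Ω) : C.coactL (C.proj ω) = 1 ⊗ₜ[K] C.proj ω := by
  have h1 : ∀ t : UniversalEnvelopingAlgebra K L ⊗[K] Ω,
      C.coactL (C.leftAct (TensorProduct.map (antipode K L) LinearMap.id t)) =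
        C.coactAntipode (TensorProduct.map LinearMap.id C.coactL.toLinearMap t) := by
    intro t
    induction t using TensorProduct.induction_on with
    | zero => simp
    | add s t hs ht => simp only [map_add, hs, ht]
    | tmul b η => simp [coactAntipode_tmul]
  have h2 : ∀ t : UniversalEnvelopingAlgebra K L ⊗[K] Ω,
      C.coactAntipode (TensorProduct.assoc K _ _ _
        (TensorProduct.map (Coalgebra.comul (R := K)) LinearMap.id t)) =
        1 ⊗ₜ[K] C.leftAct (TensorProduct.map (antipode K L) LinearMap.id t) := by
    intro t
    induction t using TensorProduct.induction_on with
    | zero => simp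
    | add s t hs ht => simp only [map_add, hs, ht, TensorProduct.tmul_add]
    | tmul b η => simpa using C.coactAntipode_comul b η
  rw [proj_apply, h1, ← C.coactL_coassoc, h2]

theorem proj_mem {ω : Ω} (h : ω ∈ C.deg 1) : C.proj ω ∈ C.leftInvariantOneForms := by
  refine ⟨?_, C.coactL_proj ω⟩
  obtain ⟨t, ht⟩ := C.coactL_deg 1 ω h
  rw [proj_apply, ← ht]
  clear ht
  induction t using TensorProduct.induction_on with
  | zero => simp
  | add s t hs ht => simp only [map_add]; exact Submodule.add_mem _ hs ht
  | tmul b η => simpa using C.incl_mul_mem _ η.2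

/-- Every form is recovered from left-invariant ones by `ω = ω₋₁ proj(ω₀)`. -/
theorem leftAct_map_proj_coactL (ω : Ω) :
    C.leftAct (TensorProduct.map LinearMap.id C.proj (C.coactL ω)) = ω := by
  have h1 : TensorProduct.map LinearMap.id C.proj (C.coactL ω) =
      TensorProduct.map LinearMap.id
        (C.leftAct ∘ₗ TensorProduct.map (antipode K L) LinearMap.id)
        (TensorProduct.map LinearMap.id C.coactL.toLinearMap (C.coactL ω)) := by
    rw [← LinearMap.comp_apply, ← TensorProduct.map_comp]
    rfl
  have h2 : ∀ (q : UniversalEnvelopingAlgebra K L ⊗[K] UniversalEnvelopingAlgebra K L) (η : Ω),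
      C.leftAct (TensorProduct.map LinearMap.id
        (C.leftAct ∘ₗ TensorProduct.map (antipode K L) LinearMap.id)
        (TensorProduct.assoc K _ _ _ (q ⊗ₜ[K] η))) =
      C.incl (LinearMap.mul' K _ (TensorProduct.map LinearMap.id (antipode K L) q)) * η := by
    intro q η
    induction q using TensorProduct.induction_on with
    | zero => simp
    | add s t hs ht => simp only [TensorProduct.add_tmul, map_add, hs, ht, add_mul]
    | tmul b c => simp [mul_assoc]
  have h3 : ∀ t : UniversalEnvelopingAlgebra K L ⊗[K] Ω,
      C.leftAct (TensorProduct.map LinearMap.id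
        (C.leftAct ∘ₗ TensorProduct.map (antipode K L) LinearMap.id)
        (TensorProduct.assoc K _ _ _
          (TensorProduct.map (Coalgebra.comul (R := K)) LinearMap.id t))) =
      TensorProduct.lid K Ω (TensorProduct.map (Coalgebra.counit (R := K)) LinearMap.id t) := by
    intro t
    induction t using TensorProduct.induction_on with
    | zero => simp
    | add s t hs ht => simp only [map_add, hs, ht]
    | tmul b η =>
      rw [TensorProduct.map_tmul, h2, mul_antipode_right, AlgHom.commutes, ← Algebra.smul_def]
      simp
  rw [h1, ← C.coactL_coassoc, h3, C.coactL_counit]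

theorem coactL_incl_mul {ω : Ω} (hω : C.coactL ω = 1 ⊗ₜ[K] ω)
    (a : UniversalEnvelopingAlgebra K L) :
    C.coactL (C.incl a * ω) =
      TensorProduct.map LinearMap.id (LinearMap.mulRight K ω ∘ₗ C.incl.toLinearMap)
        (Coalgebra.comul (R := K) a) := by
  rw [map_mul, hω, C.coactL_incl]
  induction Coalgebra.comul (R := K) a using TensorProduct.induction_on with
  | zero => simp
  | add s t hs ht => simp only [map_add, hs, ht, add_mul]
  | tmul b c => simp

theorem proj_incl_mul {ω : Ω} (hω : C.coactL ω = 1 ⊗ₜ[K] ω)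
    (a : UniversalEnvelopingAlgebra K L) :
    C.proj (C.incl a * ω) = Coalgebra.counit (R := K) a • ω := by
  have h : ∀ q : UniversalEnvelopingAlgebra K L ⊗[K] UniversalEnvelopingAlgebra K L,
      C.leftAct (TensorProduct.map (antipode K L) LinearMap.id
        (TensorProduct.map LinearMap.id (LinearMap.mulRight K ω ∘ₗ C.incl.toLinearMap) q)) =
      C.incl (LinearMap.mul' K _ (TensorProduct.map (antipode K L) LinearMap.id q)) * ω := by
    intro q
    induction q using TensorProduct.induction_on with
    | zero => simp
    | add s t hs ht => simp only [map_add, hs, ht, add_mul]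
    | tmul b c => simp [mul_assoc]
  rw [proj_apply, coactL_incl_mul C hω, h, mul_antipode_left, AlgHom.commutes, ← Algebra.smul_def]

/-- On a left-invariant form `ω`, the map `a ⊗ ω ↦ a ω` is inverted by `η ↦ η₋₁ ⊗ proj(η₀)`. -/
theorem map_proj_coactL_incl_mul {ω : Ω} (hω : C.coactL ω = 1 ⊗ₜ[K] ω)
    (a : UniversalEnvelopingAlgebra K L) :
    TensorProduct.map LinearMap.id C.proj (C.coactL (C.incl a * ω)) = a ⊗ₜ[K] ω := by
  have h : ∀ q : UniversalEnvelopingAlgebra K L ⊗[K] UniversalEnvelopingAlgebra K L,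
      TensorProduct.map LinearMap.id C.proj
        (TensorProduct.map LinearMap.id (LinearMap.mulRight K ω ∘ₗ C.incl.toLinearMap) q) =
      TensorProduct.rid K _ (TensorProduct.map LinearMap.id (Coalgebra.counit (R := K)) q)
        ⊗ₜ[K] ω := by
    intro q
    induction q using TensorProduct.induction_on with
    | zero => simp
    | add s t hs ht => simp only [map_add, hs, ht, TensorProduct.add_tmul]
    | tmul b c => simp [C.proj_incl_mul hω, TensorProduct.smul_tmul]
  rw [coactL_incl_mul C hω, h]
  congr 1
  have := Coalgebra.lTensor_counit_comul (R := K) a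
  rw [LinearMap.lTensor] at this
  rw [this]
  simp

variable {C}

theorem d_gen_injective (hC : C.IsConnected) : Function.Injective (C.d ∘ₗ C.gen) := by
  rw [injective_iff_map_eq_zero]
  intro x hx
  obtain ⟨r, hr⟩ := (hC (ι K x)).mp hx
  have h0 : Coalgebra.counit (R := K) (ι K x) = 0 := by simpa using counit_ι_mul x (1 : _)
  rw [hr, Bialgebra.counit_algebraMap] at h0
  rw [h0, map_zero] at hr
  exact PBW.ι_injective K L (hr.trans (map_zero _).symm)

theorem formMap_injective (hC : C.IsConnected) : Function.Injective C.formMap := by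
  have h : TensorProduct.map LinearMap.id C.proj ∘ₗ C.coactL.toLinearMap ∘ₗ C.formMap =
      LinearMap.lTensor (UniversalEnvelopingAlgebra K L) (C.d ∘ₗ C.gen) :=
    TensorProduct.ext' fun a x => C.map_proj_coactL_incl_mul (C.d_gen_mem_leftInvariant x).2 a
  have hinj := Module.Flat.lTensor_preserves_injective_linearMap
    (M := UniversalEnvelopingAlgebra K L) _ (d_gen_injective hC)
  rw [← h] at hinj
  exact Function.Injective.of_comp (f := TensorProduct.map LinearMap.id C.proj ∘ C.coactL) hinj

/-- In a connected calculus of classical dimension, `x ↦ dx` identifies `L` with the left-invariant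
`1`-forms. -/
theorem exists_d_gen_eq (hC : IsConnectedClassical C) {ω : Ω} (hω : ω ∈ C.leftInvariantOneForms) :
    ∃ x, C.d (C.gen x) = ω := by
  obtain ⟨hconn, _, hrank⟩ := hC
  let f : L →ₗ[K] C.leftInvariantOneForms :=
    (C.d ∘ₗ C.gen).codRestrict _ C.d_gen_mem_leftInvariant
  have hf : Function.Injective f := fun x y h => d_gen_injective hconn (congrArg Subtype.val h)
  have : Module.Finite K L := Module.Finite.of_injective f hf
  obtain ⟨x, hx⟩ :=
    (LinearMap.injective_iff_surjective_of_finrank_eq_finrank hrank.symm).mp hf ⟨ω, hω⟩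
  exact ⟨x, congrArg Subtype.val hx⟩

theorem range_formMap (hC : IsConnectedClassical C) : LinearMap.range C.formMap = C.deg 1 := by
  refine le_antisymm ?_ fun ω hω => ?_
  · rintro _ ⟨t, rfl⟩
    induction t using TensorProduct.induction_on with
    | zero => simp
    | add s t hs ht => rw [map_add]; exact Submodule.add_mem _ hs ht
    | tmul a x => exact C.incl_mul_mem a (C.d_gen_mem x)
  · obtain ⟨t, ht⟩ := C.coactL_deg 1 ω hω
    rw [← C.leftAct_map_proj_coactL ω, ← ht]
    clear ht
    induction t using TensorProduct.induction_on with
    | zero => simp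
    | add s t hs ht => simp only [map_add]; exact Submodule.add_mem _ hs ht
    | tmul a η =>
      obtain ⟨x, hx⟩ := exists_d_gen_eq hC (C.proj_mem η.2)
      exact ⟨a ⊗ₜ[K] x, by simp [DiffGradedAlgebra.formMap_tmul, hx]⟩

theorem commutator_mem (x y : L) :
    C.gen x * C.d (C.gen y) - C.d (C.gen y) * C.gen x ∈ C.leftInvariantOneForms := by
  refine ⟨Submodule.sub_mem _ (C.incl_mul_mem _ (C.d_gen_mem y)) (C.mul_incl_mem _ (C.d_gen_mem y)),
    ?_⟩
  have h : C.coactL (C.d (C.gen y)) = 1 ⊗ₜ[K] C.d (C.gen y) := (C.d_gen_mem_leftInvariant y).2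
  change C.coactL _ = 1 ⊗ₜ[K] _
  simp [h, coactL_gen, add_mul, mul_add, TensorProduct.tmul_sub]

/-- A connected calculus of classical dimension determines a pre-Lie structure by
`[x, dy] = d(x ∘ y)`. The pre-Lie identity expresses that `L` acts on the left-invariant forms by
commutators, and the formula for the Lie bracket is the derivative of `x y - y x = [x, y]`. -/
theorem existsUnique_preLieStructure (hC : IsConnectedClassical C) :
    ∃! P : PreLieStructure K L, SatisfiesPreLieRelations C.toDiffGradedAlgebra P := by
  have hinj : ∀ x y, C.d (C.gen x) = C.d (C.gen y) → x = y := fun x y h =>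
    d_gen_injective hC.1 h
  choose m hm using fun x y => exists_d_gen_eq hC (commutator_mem (C := C) x y)
  let mul : L →ₗ[K] L →ₗ[K] L := LinearMap.mk₂ K m
    (fun x x' y => hinj _ _ (by simp only [map_add, hm]; noncomm_ring))
    (fun r x y => hinj _ _ (by
      simp only [map_smul, hm, smul_mul_assoc, mul_smul_comm, smul_sub]))
    (fun x y y' => hinj _ _ (by simp only [map_add, hm]; noncomm_ring))
    (fun r x y => hinj _ _ (by
      simp only [map_smul, hm, smul_mul_assoc, mul_smul_comm, smul_sub]))
  have hmul : ∀ x y, C.d (C.gen (mul x y)) =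
      C.gen x * C.d (C.gen y) - C.d (C.gen y) * C.gen x := hm
  have hlie : ∀ x y, ⁅x, y⁆ = mul x y - mul y x := fun x y => hinj _ _ (by
    simp only [map_sub, C.gen_lie, C.d_gen_mul_gen, hmul]
    abel)
  refine ⟨⟨mul, fun x y z => hinj _ _ ?_, hlie⟩, fun x y => (hmul x y).symm, fun Q hQ => ?_⟩
  · rw [← LinearMap.sub_apply, ← map_sub, ← hlie]
    simp only [map_sub, hmul, C.gen_lie]
    noncomm_ring
  · ext x y
    exact hinj _ _ ((hQ x y).symm.trans (hmul x y).symm)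

end BicovariantDGA

end Structure

/-! ### The differential algebra of a pre-Lie structure -/

namespace PreLieStructure

attribute [local instance 100] LieRing.ofAssociativeRing

open UniversalEnvelopingAlgebra

section Algebra

variable {K : Type u} [CommRing K] {L : Type v} [LieRing L] [LieAlgebra K L]
  (P : PreLieStructure K L)

/-- The defining relations of the algebra of forms of a pre-Lie structure, with `(x, 0)` standing
for the function `x` and `(0, y)` for the form `dy`: `x y - y x = [x, y]`, `x dy - dy x = d(x ∘ y)`
and `dx dy + dy dx = 0`. -/
inductive FormRel : TensorAlgebra K (L × L) → TensorAlgebra K (L × L) → Prop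
  | lie (x y : L) : FormRel (TensorAlgebra.ι K (x, 0) * TensorAlgebra.ι K (y, 0))
      (TensorAlgebra.ι K (y, 0) * TensorAlgebra.ι K (x, 0) + TensorAlgebra.ι K (⁅x, y⁆, 0))
  | mul (x y : L) : FormRel (TensorAlgebra.ι K (x, 0) * TensorAlgebra.ι K (0, y))
      (TensorAlgebra.ι K (0, y) * TensorAlgebra.ι K (x, 0) + TensorAlgebra.ι K (0, P.mul x y))
  | anti (x y : L) : FormRel (TensorAlgebra.ι K (0, x) * TensorAlgebra.ι K (0, y))
      (-(TensorAlgebra.ι K (0, y) * TensorAlgebra.ι K (0, x)))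

/-- The algebra of forms of a pre-Lie structure, generated by the functions `x` and the forms `dx`
for `x ∈ L` with the relations `FormRel`. -/
def Forms : Type (max u v) := RingQuot (FormRel P)

noncomputable instance : Ring P.Forms := inferInstanceAs (Ring (RingQuot (FormRel P)))

noncomputable instance : Algebra K P.Forms := inferInstanceAs (Algebra K (RingQuot (FormRel P)))

namespace Forms

/-- The quotient map onto the algebra of forms. -/
noncomputable def mk : TensorAlgebra K (L × L) →ₐ[K] P.Forms := RingQuot.mkAlgHom K (FormRel P)

/-- The generating functions `x`. -/
noncomputable def fn : L →ₗ[K] P.Forms :=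
  (mk P).toLinearMap ∘ₗ TensorAlgebra.ι K ∘ₗ LinearMap.inl K L L

/-- The generating forms `dx`. -/
noncomputable def form : L →ₗ[K] P.Forms :=
  (mk P).toLinearMap ∘ₗ TensorAlgebra.ι K ∘ₗ LinearMap.inr K L L

variable {P}

theorem fn_mul_fn (x y : L) : fn P x * fn P y = fn P y * fn P x + fn P ⁅x, y⁆ := by
  have h : mk P _ = mk P _ := RingQuot.mkAlgHom_rel K (FormRel.lie (P := P) x y)
  rwa [map_add, map_mul, map_mul] at h

theorem fn_mul_form (x y : L) :
    fn P x * form P y = form P y * fn P x + form P (P.mul x y) := by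
  have h : mk P _ = mk P _ := RingQuot.mkAlgHom_rel K (FormRel.mul (P := P) x y)
  rwa [map_add, map_mul, map_mul] at h

theorem form_mul_form (x y : L) : form P x * form P y = -(form P y * form P x) := by
  have h : mk P _ = mk P _ := RingQuot.mkAlgHom_rel K (FormRel.anti (P := P) x y)
  rwa [map_neg, map_mul, map_mul] at h

section Lift

variable {B : Type*} [Ring B] [Algebra K B]

/-- The universal property of the algebra of forms. -/
noncomputable def lift (f g : L →ₗ[K] B) (hlie : ∀ x y, f x * f y = f y * f x + f ⁅x, y⁆)
    (hmul : ∀ x y, f x * g y = g y * f x + g (P.mul x y))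
    (hanti : ∀ x y, g x * g y = -(g y * g x)) : P.Forms →ₐ[K] B :=
  RingQuot.liftAlgHom K ⟨TensorAlgebra.lift K (f.coprod g), by
    rintro _ _ (⟨x, y⟩ | ⟨x, y⟩ | ⟨x, y⟩)
    · simpa using hlie x y
    · simpa using hmul x y
    · simpa only [map_mul, map_neg, TensorAlgebra.lift_ι_apply, LinearMap.coprod_apply, map_zero,
        zero_add] using hanti x y⟩

variable {f g : L →ₗ[K] B} {hlie : ∀ x y, f x * f y = f y * f x + f ⁅x, y⁆}
    {hmul : ∀ x y, f x * g y = g y * f x + g (P.mul x y)}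
    {hanti : ∀ x y, g x * g y = -(g y * g x)}

theorem lift_mk (t : TensorAlgebra K (L × L)) :
    lift f g hlie hmul hanti (mk P t) = TensorAlgebra.lift K (f.coprod g) t :=
  RingQuot.liftAlgHom_mkAlgHom_apply K _ _ t

@[simp]
theorem lift_fn (x : L) : lift f g hlie hmul hanti (fn P x) = f x :=
  (lift_mk _).trans (by simp)

@[simp]
theorem lift_form (x : L) : lift f g hlie hmul hanti (form P x) = g x :=
  (lift_mk _).trans (by simp)

end Lift

theorem algHom_ext {B : Type*} [Semiring B] [Algebra K B] {f g : P.Forms →ₐ[K] B}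
    (hf : ∀ x, f (fn P x) = g (fn P x)) (hg : ∀ x, f (form P x) = g (form P x)) : f = g := by
  refine RingQuot.ringQuot_ext' (S := K) (s := FormRel P) f g (TensorAlgebra.hom_ext ?_)
  exact LinearMap.prod_ext (LinearMap.ext hf) (LinearMap.ext hg)

theorem adjoin_eq_top :
    Algebra.adjoin K (Set.range (fn P) ∪ Set.range (form P)) = ⊤ := by
  rw [eq_top_iff]
  have h1 : (mk P).range ≤ Algebra.adjoin K (Set.range (fn P) ∪ Set.range (form P)) := by
    rw [← Algebra.map_top, ← TensorAlgebra.adjoin_range_ι, AlgHom.map_adjoin,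
      Algebra.adjoin_le_iff]
    rintro _ ⟨_, ⟨⟨x, y⟩, rfl⟩, rfl⟩
    have : mk P (TensorAlgebra.ι K (x, y)) = fn P x + form P y := by
      simp [fn, form, ← map_add]
    rw [this]
    exact add_mem (Algebra.subset_adjoin (Or.inl ⟨x, rfl⟩))
      (Algebra.subset_adjoin (Or.inr ⟨y, rfl⟩))
  intro ω _
  exact h1 (RingQuot.mkAlgHom_surjective K (FormRel P) ω)

/-- Induction over left multiplication by the generators. -/
theorem induction {p : P.Forms → Prop} (ω : P.Forms) (one : p 1)
    (add : ∀ ω η, p ω → p η → p (ω + η)) (smul : ∀ (r : K) ω, p ω → p (r • ω))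
    (fn_mul : ∀ x ω, p ω → p (fn P x * ω)) (form_mul : ∀ x ω, p ω → p (form P x * ω)) : p ω := by
  let q : Submodule K P.Forms :=
    { carrier := {ω | p ω}
      add_mem' := fun {a b} => add a b
      zero_mem' := by simpa using smul 0 1 one
      smul_mem' := smul }
  have : q = ⊤ := by
    refine Submodule.eq_top_of_mul_mem adjoin_eq_top q one ?_
    rintro _ (⟨x, rfl⟩ | ⟨x, rfl⟩) a ha
    exacts [fn_mul x a ha, form_mul x a ha]
  exact (this ▸ Submodule.mem_top : ω ∈ q)

/-! ### Differential -/

variable (P) in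
/-- The algebra map `ω ↦ !![α ω, d ω; 0, ω]` which packages the differential `d`, a derivation
twisted by the parity automorphism `α`. -/
noncomputable def dHom : P.Forms →ₐ[K] Matrix (Fin 2) (Fin 2) P.Forms :=
  lift
    { toFun := fun x => !![fn P x, form P x; 0, fn P x]
      map_add' := fun x y => by ext i j; fin_cases i <;> fin_cases j <;> simp
      map_smul' := fun r x => by ext i j; fin_cases i <;> fin_cases j <;> simp }
    { toFun := fun x => !![-form P x, 0; 0, form P x]
      map_add' := fun x y => by ext i j; fin_cases i <;> fin_cases j <;> simp [add_comm]
      map_smul' := fun r x => by ext i j; fin_cases i <;> fin_cases j <;> simp }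
    (fun x y => by
      ext i j
      fin_cases i <;> fin_cases j <;>
        simp [fn_mul_fn x y, Matrix.mul_apply, Fin.sum_univ_two]
      rw [fn_mul_form x y, fn_mul_form y x, P.lie_eq, map_sub]
      abel)
    (fun x y => by
      ext i j
      fin_cases i <;> fin_cases j <;>
        simp [fn_mul_form x y, Matrix.mul_apply, Fin.sum_univ_two, add_comm]
      rw [form_mul_form])
    (fun x y => by
      ext i j
      fin_cases i <;> fin_cases j <;>
        simp [Matrix.mul_apply, Fin.sum_univ_two, form_mul_form x y])

variable (P) in
/-- The differential on the algebra of forms. -/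
noncomputable def d : P.Forms →ₗ[K] P.Forms :=
  (Matrix.entryLinearMap K P.Forms 0 1) ∘ₗ (dHom P).toLinearMap

theorem d_apply (ω : P.Forms) : d P ω = dHom P ω 0 1 := rfl

theorem dHom_fn (x : L) : dHom P (fn P x) = !![fn P x, form P x; 0, fn P x] := lift_fn x

theorem dHom_form (x : L) : dHom P (form P x) = !![-form P x, 0; 0, form P x] := lift_form x

theorem dHom_one_zero (ω : P.Forms) : dHom P ω 1 0 = 0 := by
  induction ω using induction with
  | one => simp
  | add ω η h h' => simp [h, h']
  | smul r ω h => simp [h]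
  | fn_mul x ω h => simp [dHom_fn, Matrix.mul_apply, Fin.sum_univ_two, h]
  | form_mul x ω h => simp [dHom_form, Matrix.mul_apply, Fin.sum_univ_two, h]

theorem dHom_one_one (ω : P.Forms) : dHom P ω 1 1 = ω := by
  induction ω using induction with
  | one => simp
  | add ω η h h' => simp [h, h']
  | smul r ω h => simp [h]
  | fn_mul x ω h => simp [dHom_fn, Matrix.mul_apply, Fin.sum_univ_two, h]
  | form_mul x ω h => simp [dHom_form, Matrix.mul_apply, Fin.sum_univ_two, h]

theorem d_mul (ω η : P.Forms) : d P (ω * η) = d P ω * η + dHom P ω 0 0 * d P η := by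
  simp [d_apply, Matrix.mul_apply, Fin.sum_univ_two, dHom_one_one, add_comm]

@[simp]
theorem d_one : d P 1 = 0 := by simp [d_apply]

@[simp]
theorem d_fn (x : L) : d P (fn P x) = form P x := by simp [d_apply, dHom_fn]

@[simp]
theorem d_form (x : L) : d P (form P x) = 0 := by simp [d_apply, dHom_form]

theorem d_fn_mul (x : L) (ω : P.Forms) :
    d P (fn P x * ω) = form P x * ω + fn P x * d P ω := by
  rw [d_mul, d_fn, dHom_fn]
  simp

theorem d_form_mul (x : L) (ω : P.Forms) : d P (form P x * ω) = -(form P x * d P ω) := by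
  rw [d_mul, d_form, dHom_form]
  simp

theorem d_d (ω : P.Forms) : d P (d P ω) = 0 := by
  induction ω using induction with
  | one => simp
  | add ω η h h' => simp [h, h']
  | smul r ω h => simp [h]
  | fn_mul x ω h => simp [d_fn_mul, d_form_mul, h]
  | form_mul x ω h => simp [d_form_mul, h]

/-! ### Grading -/

open Polynomial in
variable (P) in
/-- The grading of the algebra of forms, as the algebra map which sends a form `ω` of degree `n` to
`ω Tⁿ`. -/
noncomputable def gradeHom : P.Forms →ₐ[K] P.Forms[X] :=
  lift
    { toFun := fun x => C (fn P x)
      map_add' := fun x y => by simp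
      map_smul' := fun r x => by simp [smul_C] }
    { toFun := fun x => C (form P x) * X
      map_add' := fun x y => by simp [add_mul]
      map_smul' := fun r x => by simp [← smul_C] }
    (fun x y => by
      simp only [LinearMap.coe_mk, AddHom.coe_mk]
      rw [← C_mul, ← C_mul, ← C_add, fn_mul_fn])
    (fun x y => by
      simp only [LinearMap.coe_mk, AddHom.coe_mk]
      rw [mul_assoc, X_mul_C, ← mul_assoc, ← mul_assoc, ← C_mul, ← C_mul, fn_mul_form, C_add,
        add_mul])
    (fun x y => by
      simp only [LinearMap.coe_mk, AddHom.coe_mk]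
      rw [C_mul_X_eq_monomial, C_mul_X_eq_monomial, monomial_mul_monomial, monomial_mul_monomial,
        form_mul_form, map_neg])

open Polynomial in
theorem gradeHom_fn (x : L) : gradeHom P (fn P x) = C (fn P x) := lift_fn x

open Polynomial in
theorem gradeHom_form (x : L) : gradeHom P (form P x) = C (form P x) * X := lift_form x

open Polynomial in
variable (P) in
/-- The forms of degree `n`. -/
noncomputable def deg (n : ℕ) : Submodule K P.Forms where
  carrier := {ω | gradeHom P ω = monomial n ω}
  add_mem' {ω η} hω hη := by
    simp only [Set.mem_ofPred_eq] at hω hη ⊢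
    rw [map_add, hω, hη, map_add]
  zero_mem' := by simp
  smul_mem' r ω hω := by
    simp only [Set.mem_ofPred_eq] at hω ⊢
    rw [map_smul, hω, smul_monomial]

open Polynomial in
theorem mem_deg {n : ℕ} {ω : P.Forms} : ω ∈ deg P n ↔ gradeHom P ω = monomial n ω := Iff.rfl

open Polynomial in
theorem one_mem_deg : (1 : P.Forms) ∈ deg P 0 := by simp [mem_deg]

open Polynomial in
theorem mul_mem_deg {m n : ℕ} {ω η : P.Forms} (hω : ω ∈ deg P m) (hη : η ∈ deg P n) :
    ω * η ∈ deg P (m + n) := by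
  rw [mem_deg] at *
  rw [map_mul, hω, hη, monomial_mul_monomial]

open Polynomial in
theorem fn_mem_deg (x : L) : fn P x ∈ deg P 0 := by simp [mem_deg, gradeHom_fn]

open Polynomial in
theorem form_mem_deg (x : L) : form P x ∈ deg P 1 := by
  rw [mem_deg, gradeHom_form, C_mul_X_eq_monomial]

theorem fn_mul_mem_deg (x : L) {n : ℕ} {ω : P.Forms} (h : ω ∈ deg P n) :
    fn P x * ω ∈ deg P n := by
  simpa using mul_mem_deg (fn_mem_deg x) h

theorem form_mul_mem_deg (x : L) {n : ℕ} {ω : P.Forms} (h : ω ∈ deg P n) :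
    form P x * ω ∈ deg P (n + 1) := by
  simpa [add_comm] using mul_mem_deg (form_mem_deg x) h

/-- A family of subspaces which is stable under multiplication by the generators contains the
homogeneous components of all forms. -/
theorem coeff_gradeHom_mem (Q : ℕ → Submodule K P.Forms) (one : 1 ∈ Q 0)
    (fn_mul : ∀ n x, ∀ ω ∈ Q n, fn P x * ω ∈ Q n)
    (form_mul : ∀ n x, ∀ ω ∈ Q n, form P x * ω ∈ Q (n + 1)) (ω : P.Forms) (n : ℕ) :
    (gradeHom P ω).coeff n ∈ Q n := by
  induction ω using induction generalizing n with
  | one =>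
    rw [map_one, Polynomial.coeff_one]
    split_ifs with h
    · exact h ▸ one
    · exact zero_mem _
  | add ω η h h' => simpa using add_mem (h n) (h' n)
  | smul r ω h => simpa using Submodule.smul_mem _ r (h n)
  | fn_mul x ω h => simpa [gradeHom_fn] using fn_mul n x _ (h n)
  | form_mul x ω h =>
    rw [map_mul, gradeHom_form, mul_assoc, Polynomial.coeff_C_mul]
    cases n with
    | zero => simp
    | succ n => simpa using form_mul n x _ (h n)

/-- Induction over homogeneous forms by left multiplication by the generators. -/
theorem deg_le (Q : ℕ → Submodule K P.Forms) (one : 1 ∈ Q 0)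
    (fn_mul : ∀ n x, ∀ ω ∈ Q n, fn P x * ω ∈ Q n)
    (form_mul : ∀ n x, ∀ ω ∈ Q n, form P x * ω ∈ Q (n + 1)) (n : ℕ) : deg P n ≤ Q n := by
  intro ω hω
  have := coeff_gradeHom_mem Q one fn_mul form_mul ω n
  rwa [mem_deg.mp hω, Polynomial.coeff_monomial_same] at this

theorem coeff_gradeHom_mem_deg (ω : P.Forms) (n : ℕ) : (gradeHom P ω).coeff n ∈ deg P n :=
  coeff_gradeHom_mem _ one_mem_deg (fun _ x _ h => fn_mul_mem_deg x h)
    (fun _ x _ h => form_mul_mem_deg x h) ω n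

theorem eval_one_gradeHom (ω : P.Forms) : (gradeHom P ω).eval 1 = ω := by
  induction ω using induction with
  | one => simp
  | add ω η h h' => simp [h, h']
  | smul r ω h => simp [h]
  | fn_mul x ω h => simp [gradeHom_fn, h]
  | form_mul x ω h =>
    rw [map_mul, gradeHom_form, mul_assoc, Polynomial.X_mul, Polynomial.eval_C_mul]
    simp [h]

/-- The homogeneous components of `ω` are the coefficients of `gradeHom ω`. -/
theorem isInternal_deg : DirectSum.IsInternal (deg P) := by
  constructor
  · refine (injective_iff_map_eq_zero _).mpr fun s hs => DFinsupp.ext fun n => Subtype.ext ?_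
    have h : (Polynomial.lcoeff P.Forms n).restrictScalars K ∘ₗ (gradeHom P).toLinearMap ∘ₗ
        DirectSum.coeLinearMap (deg P) = (deg P n).subtype ∘ₗ DirectSum.component K ℕ _ n := by
      refine DirectSum.linearMap_ext _ fun m => LinearMap.ext fun ω => ?_
      have hω := mem_deg.mp ω.2
      by_cases hmn : m = n
      · subst hmn
        simp [← DirectSum.apply_eq_component, hω]
      · simp only [LinearMap.comp_apply, DirectSum.coeLinearMap_lof, AlgHom.toLinearMap_apply, hω,
          LinearMap.coe_restrictScalars, Polynomial.lcoeff_apply, Polynomial.coeff_monomial,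
          if_neg hmn, DirectSum.component.of, dif_neg hmn, map_zero]
    have := LinearMap.congr_fun h s
    have hs' : DirectSum.coeLinearMap (deg P) s = 0 := hs
    simp only [LinearMap.comp_apply, hs', map_zero] at this
    exact this.symm
  · intro ω
    refine ⟨∑ n ∈ (gradeHom P ω).support,
      DirectSum.of (fun n => deg P n) n ⟨_, coeff_gradeHom_mem_deg ω n⟩, ?_⟩
    rw [map_sum]
    simp only [DirectSum.coeAddMonoidHom_of]
    conv_rhs => rw [← eval_one_gradeHom ω, Polynomial.eval_eq_sum]
    simp [Polynomial.sum]

variable (P) in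
noncomputable instance gradedAlgebra : GradedAlgebra (deg P) where
  one_mem := one_mem_deg
  mul_mem _ _ _ _ := mul_mem_deg
  toDecomposition := isInternal_deg.chooseDecomposition

theorem d_mem_deg {n : ℕ} {ω : P.Forms} (h : ω ∈ deg P n) : d P ω ∈ deg P (n + 1) := by
  refine (deg_le (fun n => deg P n ⊓ (deg P (n + 1)).comap (d P)) ⟨one_mem_deg, by simp⟩
    ?_ ?_ n h).2
  · rintro n x ω ⟨h, h'⟩
    refine ⟨fn_mul_mem_deg x h, ?_⟩
    change d P (fn P x * ω) ∈ deg P (n + 1)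
    rw [d_fn_mul]
    exact add_mem (form_mul_mem_deg x h) (fn_mul_mem_deg x h')
  · rintro n x ω ⟨h, h'⟩
    refine ⟨form_mul_mem_deg x h, ?_⟩
    change d P (form P x * ω) ∈ deg P (n + 1 + 1)
    rw [d_form_mul]
    exact neg_mem (form_mul_mem_deg x h')

/-- The parity automorphism `α` is `(-1)ⁿ` in degree `n`, so that `d` is a graded derivation. -/
theorem dHom_zero_zero {n : ℕ} {ω : P.Forms} (h : ω ∈ deg P n) :
    dHom P ω 0 0 = (-1) ^ n * ω := by
  refine deg_le (fun n => LinearMap.eqLocus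
    (Matrix.entryLinearMap K P.Forms 0 0 ∘ₗ (dHom P).toLinearMap)
    (LinearMap.mulLeft K ((-1) ^ n))) ?_ ?_ ?_ n h
  · simp
  · intro n x ω h
    simp only [LinearMap.mem_eqLocus, LinearMap.comp_apply, AlgHom.toLinearMap_apply,
      Matrix.entryLinearMap_apply, LinearMap.mulLeft_apply] at h ⊢
    rw [map_mul, Matrix.mul_apply, Fin.sum_univ_two, dHom_fn, h, dHom_one_zero, ← mul_assoc,
      ← mul_assoc]
    simp [((Commute.neg_one_left (fn P x)).pow_left n).eq]
  · intro n x ω h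
    simp only [LinearMap.mem_eqLocus, LinearMap.comp_apply, AlgHom.toLinearMap_apply,
      Matrix.entryLinearMap_apply, LinearMap.mulLeft_apply] at h ⊢
    rw [map_mul, Matrix.mul_apply, Fin.sum_univ_two, dHom_form, h, dHom_one_zero, ← mul_assoc,
      ← mul_assoc, pow_succ]
    simp [((Commute.neg_one_left (form P x)).pow_left n).eq]

/-! ### Functions -/

variable (P) in
/-- The inclusion of `U(L)` in the algebra of forms. -/
noncomputable def incl : UniversalEnvelopingAlgebra K L →ₐ[K] P.Forms :=
  UniversalEnvelopingAlgebra.lift K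
    { fn P with
      map_lie' := fun {x y} => by
        simp [LieRing.of_associative_ring_bracket, fn_mul_fn x y] }

theorem incl_ι (x : L) : incl P (ι K x) = fn P x := UniversalEnvelopingAlgebra.lift_ι_apply K _ x

theorem incl_ι_mul (x : L) (a : UniversalEnvelopingAlgebra K L) :
    incl P (ι K x * a) = fn P x * incl P a := by
  rw [map_mul, incl_ι]

variable (P) in
/-- The algebra map from the forms to `U(L)` which kills all `dx`. -/
noncomputable def toFn : P.Forms →ₐ[K] UniversalEnvelopingAlgebra K L :=
  lift (ι K : L →ₗ⁅K⁆ UniversalEnvelopingAlgebra K L) 0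
    (fun x y => by
      simp only [LieHom.coe_toLinearMap, LieHom.map_lie, LieRing.of_associative_ring_bracket]
      abel)
    (by simp) (by simp)

theorem incl_injective : Function.Injective (incl P) := by
  have h : (toFn P).comp (incl P) = AlgHom.id K _ := algHom_eq_of_ι K L fun x => by
    rw [AlgHom.comp_apply, incl_ι, toFn, lift_fn]
    rfl
  exact Function.LeftInverse.injective (g := toFn P) fun a => DFunLike.congr_fun h a

theorem range_incl : LinearMap.range (incl P).toLinearMap = deg P 0 := by
  apply le_antisymm
  · have h : (⊤ : Submodule K _) ≤ (deg P 0).comap (incl P).toLinearMap := by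
      rw [Submodule.eq_top_of_mul_mem adjoin_range_ι ((deg P 0).comap (incl P).toLinearMap)]
      · simpa using one_mem_deg
      · rintro _ ⟨x, rfl⟩ a ha
        simpa only [Submodule.mem_comap, AlgHom.toLinearMap_apply, incl_ι_mul] using
          fn_mul_mem_deg x ha
    rintro _ ⟨a, rfl⟩
    exact h (Submodule.mem_top : a ∈ ⊤)
  · refine deg_le (fun | 0 => LinearMap.range (incl P).toLinearMap | _ + 1 => ⊤)
      (⟨1, map_one (incl P)⟩ : 1 ∈ LinearMap.range (incl P).toLinearMap) ?_
      (fun _ _ _ _ => Submodule.mem_top) 0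
    rintro (_ | n) x ω hω
    · obtain ⟨a, rfl⟩ := hω
      exact ⟨ι K x * a, incl_ι_mul x a⟩
    · exact Submodule.mem_top

/-- The one-forms are spanned by the forms `dx a` with `x ∈ L` and `a ∈ U(L)`. -/
theorem deg_one_le : deg P 1 ≤
    Submodule.span K (Set.range fun t : L × UniversalEnvelopingAlgebra K L =>
      form P t.1 * incl P t.2) := by
  set M := Submodule.span K (Set.range fun t : L × UniversalEnvelopingAlgebra K L =>
      form P t.1 * incl P t.2) with hM
  -- only degrees `0` and `1` matter, so nothing is claimed in higher degrees
  refine deg_le (fun | 0 => LinearMap.range (incl P).toLinearMap | 1 => M | _ + 2 => ⊤)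
    (⟨1, map_one (incl P)⟩ : 1 ∈ LinearMap.range (incl P).toLinearMap) ?_ ?_ 1
  · rintro (_ | _ | n) x ω hω
    · obtain ⟨a, rfl⟩ := hω
      exact ⟨ι K x * a, incl_ι_mul x a⟩
    · change ω ∈ M at hω
      change fn P x * ω ∈ M
      refine Submodule.span_le (p := M.comap (LinearMap.mulLeft K (fn P x))).mpr ?_ hω
      rintro _ ⟨⟨y, a⟩, rfl⟩
      have : fn P x * (form P y * incl P a) =
          form P y * incl P (ι K x * a) + form P (P.mul x y) * incl P a := by
        rw [← mul_assoc, fn_mul_form, add_mul, incl_ι_mul, mul_assoc]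
      simp only [SetLike.mem_coe, Submodule.mem_comap, LinearMap.mulLeft_apply, this]
      exact add_mem (Submodule.subset_span ⟨(y, ι K x * a), rfl⟩)
        (Submodule.subset_span ⟨(P.mul x y, a), rfl⟩)
    · exact Submodule.mem_top
  · rintro (_ | n) x ω hω
    · obtain ⟨a, rfl⟩ := hω
      exact Submodule.subset_span ⟨(x, a), rfl⟩
    · exact Submodule.mem_top

variable (P) in
/-- The differential graded algebra of a pre-Lie structure. -/
noncomputable def dga : DiffGradedAlgebra K (UniversalEnvelopingAlgebra K L) P.Forms where
  deg := deg P
  graded := gradedAlgebra P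
  incl := incl P
  incl_injective := incl_injective
  range_incl := range_incl
  d := d P
  d_mem _ _ := d_mem_deg
  d_d := d_d
  leibniz n ω η h := by rw [d_mul, dHom_zero_zero h, mul_assoc]

end Forms

end Algebra

end PreLieStructure

namespace PreLieStructure

attribute [local instance 100] LieRing.ofAssociativeRing

open UniversalEnvelopingAlgebra

namespace Forms

section Coactions

variable {K : Type u} [CommRing K] {L : Type v} [LieRing L] [LieAlgebra K L]
  {P : PreLieStructure K L}

/-! ### Coactions -/

variable (P) in
/-- The left coaction on the algebra of forms, for which the forms `dx` are left-invariant. -/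
noncomputable def coactL : P.Forms →ₐ[K] UniversalEnvelopingAlgebra K L ⊗[K] P.Forms :=
  lift
    ((TensorProduct.mk K _ _).flip 1 ∘ₗ (ι K : L →ₗ⁅K⁆ UniversalEnvelopingAlgebra K L).toLinearMap +
      TensorProduct.mk K _ _ 1 ∘ₗ fn P)
    (TensorProduct.mk K _ _ 1 ∘ₗ form P)
    (fun x y => by
      simp [-ι_apply, LieRing.of_associative_ring_bracket, fn_mul_fn x y, mul_add, add_mul,
        TensorProduct.tmul_add]
      abel)
    (fun x y => by
      simp [-ι_apply, fn_mul_form x y, mul_add, add_mul, TensorProduct.tmul_add]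
      abel)
    (fun x y => by simp [form_mul_form x y, TensorProduct.tmul_neg])

variable (P) in
/-- The right coaction on the algebra of forms, for which the forms `dx` are right-invariant. -/
noncomputable def coactR : P.Forms →ₐ[K] P.Forms ⊗[K] UniversalEnvelopingAlgebra K L :=
  lift
    ((TensorProduct.mk K _ _).flip 1 ∘ₗ fn P +
      TensorProduct.mk K _ _ 1 ∘ₗ (ι K : L →ₗ⁅K⁆ UniversalEnvelopingAlgebra K L).toLinearMap)
    ((TensorProduct.mk K _ _).flip 1 ∘ₗ form P)
    (fun x y => by
      simp [-ι_apply, LieRing.of_associative_ring_bracket, fn_mul_fn x y, mul_add, add_mul,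
        TensorProduct.add_tmul, TensorProduct.tmul_sub]
      abel)
    (fun x y => by
      simp [-ι_apply, fn_mul_form x y, mul_add, add_mul, TensorProduct.add_tmul]
      abel)
    (fun x y => by simp [form_mul_form x y, TensorProduct.neg_tmul])

theorem coactL_fn (x : L) : coactL P (fn P x) = ι K x ⊗ₜ[K] 1 + 1 ⊗ₜ[K] fn P x := lift_fn x

theorem coactL_form (x : L) : coactL P (form P x) = 1 ⊗ₜ[K] form P x := lift_form x

theorem coactR_fn (x : L) : coactR P (fn P x) = fn P x ⊗ₜ[K] 1 + 1 ⊗ₜ[K] ι K x := lift_fn x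

theorem coactR_form (x : L) : coactR P (form P x) = form P x ⊗ₜ[K] 1 := lift_form x

theorem comul_ι (x : L) :
    Bialgebra.comulAlgHom K (UniversalEnvelopingAlgebra K L) (ι K x) =
      ι K x ⊗ₜ[K] 1 + 1 ⊗ₜ[K] ι K x :=
  comulHom_ι K L x

theorem counit_ι (x : L) :
    Bialgebra.counitAlgHom K (UniversalEnvelopingAlgebra K L) (ι K x) = 0 :=
  counitHom_ι K L x

theorem coactL_incl (a : UniversalEnvelopingAlgebra K L) :
    coactL P (incl P a) =
      TensorProduct.map LinearMap.id (incl P).toLinearMap (Coalgebra.comul (R := K) a) := by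
  have h : (coactL P).comp (incl P) = (Algebra.TensorProduct.map (AlgHom.id K _) (incl P)).comp
      (Bialgebra.comulAlgHom K _) := algHom_eq_of_ι K L fun x => by
    simp only [AlgHom.comp_apply, incl_ι, coactL_fn, comul_ι, map_add,
      Algebra.TensorProduct.map_tmul, map_one, AlgHom.id_apply]
  exact DFunLike.congr_fun h a

theorem coactR_incl (a : UniversalEnvelopingAlgebra K L) :
    coactR P (incl P a) =
      TensorProduct.map (incl P).toLinearMap LinearMap.id (Coalgebra.comul (R := K) a) := by
  have h : (coactR P).comp (incl P) = (Algebra.TensorProduct.map (incl P) (AlgHom.id K _)).comp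
      (Bialgebra.comulAlgHom K _) := algHom_eq_of_ι K L fun x => by
    simp only [AlgHom.comp_apply, incl_ι, coactR_fn, comul_ι, map_add,
      Algebra.TensorProduct.map_tmul, map_one, AlgHom.id_apply]
  exact DFunLike.congr_fun h a

theorem coactL_d (ω : P.Forms) :
    coactL P (d P ω) = TensorProduct.map LinearMap.id (d P) (coactL P ω) := by
  induction ω using induction with
  | one => simp [Algebra.TensorProduct.one_def]
  | add ω η h h' => simp [h, h']
  | smul r ω h => simp [h]
  | fn_mul x ω h =>
    rw [d_fn_mul, map_add, map_mul, map_mul, map_mul, h, coactL_form, coactL_fn]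
    induction coactL P ω using TensorProduct.induction_on with
    | zero => simp
    | add s t hs ht => simp only [mul_add, map_add] at hs ht ⊢; rw [← hs, ← ht]; abel
    | tmul a η => simp [-ι_apply, add_mul, d_fn_mul, TensorProduct.tmul_add]; abel
  | form_mul x ω h =>
    rw [d_form_mul, map_neg, map_mul, map_mul, h, coactL_form]
    induction coactL P ω using TensorProduct.induction_on with
    | zero => simp
    | add s t hs ht => simp only [mul_add, map_add, neg_add] at hs ht ⊢; rw [← hs, ← ht]
    | tmul a η => simp [d_form_mul, TensorProduct.tmul_neg]

theorem coactR_d (ω : P.Forms) :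
    coactR P (d P ω) = TensorProduct.map (d P) LinearMap.id (coactR P ω) := by
  induction ω using induction with
  | one => simp [Algebra.TensorProduct.one_def]
  | add ω η h h' => simp [h, h']
  | smul r ω h => simp [h]
  | fn_mul x ω h =>
    rw [d_fn_mul, map_add, map_mul, map_mul, map_mul, h, coactR_form, coactR_fn]
    induction coactR P ω using TensorProduct.induction_on with
    | zero => simp
    | add s t hs ht => simp only [mul_add, map_add] at hs ht ⊢; rw [← hs, ← ht]; abel
    | tmul a η => simp [-ι_apply, add_mul, d_fn_mul, TensorProduct.add_tmul]; abel
  | form_mul x ω h =>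
    rw [d_form_mul, map_neg, map_mul, map_mul, h, coactR_form]
    induction coactR P ω using TensorProduct.induction_on with
    | zero => simp
    | add s t hs ht => simp only [mul_add, map_add, neg_add] at hs ht ⊢; rw [← hs, ← ht]
    | tmul a η => simp [d_form_mul, TensorProduct.neg_tmul]

theorem coactL_deg {n : ℕ} {ω : P.Forms} (hω : ω ∈ deg P n) : coactL P ω ∈
    LinearMap.range (TensorProduct.map
      (LinearMap.id : UniversalEnvelopingAlgebra K L →ₗ[K] _) (deg P n).subtype) := by
  refine deg_le (fun n => (LinearMap.range (TensorProduct.map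
    (LinearMap.id : UniversalEnvelopingAlgebra K L →ₗ[K] _) (deg P n).subtype)).comap
      (coactL P).toLinearMap) ?_ ?_ ?_ n hω
  · exact ⟨1 ⊗ₜ ⟨1, one_mem_deg⟩, by simp [Algebra.TensorProduct.one_def]⟩
  · rintro n x ω ⟨t, ht⟩
    simp only [Submodule.mem_comap, AlgHom.toLinearMap_apply] at ht ⊢
    rw [map_mul, ← ht, coactL_fn]
    clear ht
    induction t using TensorProduct.induction_on with
    | zero => simp
    | add s t hs ht => rw [map_add, mul_add]; exact add_mem hs ht
    | tmul a η =>
      exact ⟨(ι K x * a) ⊗ₜ η + a ⊗ₜ ⟨_, fn_mul_mem_deg x η.2⟩, by simp [-ι_apply, add_mul]⟩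
  · rintro n x ω ⟨t, ht⟩
    simp only [Submodule.mem_comap, AlgHom.toLinearMap_apply] at ht ⊢
    rw [map_mul, ← ht, coactL_form]
    clear ht
    induction t using TensorProduct.induction_on with
    | zero => simp
    | add s t hs ht => rw [map_add, mul_add]; exact add_mem hs ht
    | tmul a η => exact ⟨a ⊗ₜ ⟨_, form_mul_mem_deg x η.2⟩, by simp⟩

theorem coactR_deg {n : ℕ} {ω : P.Forms} (hω : ω ∈ deg P n) : coactR P ω ∈
    LinearMap.range (TensorProduct.map (deg P n).subtype
      (LinearMap.id : UniversalEnvelopingAlgebra K L →ₗ[K] _)) := by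
  refine deg_le (fun n => (LinearMap.range (TensorProduct.map (deg P n).subtype
    (LinearMap.id : UniversalEnvelopingAlgebra K L →ₗ[K] _))).comap
      (coactR P).toLinearMap) ?_ ?_ ?_ n hω
  · exact ⟨⟨1, one_mem_deg⟩ ⊗ₜ 1, by simp [Algebra.TensorProduct.one_def]⟩
  · rintro n x ω ⟨t, ht⟩
    simp only [Submodule.mem_comap, AlgHom.toLinearMap_apply] at ht ⊢
    rw [map_mul, ← ht, coactR_fn]
    clear ht
    induction t using TensorProduct.induction_on with
    | zero => simp
    | add s t hs ht => rw [map_add, mul_add]; exact add_mem hs ht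
    | tmul η a =>
      exact ⟨⟨_, fn_mul_mem_deg x η.2⟩ ⊗ₜ a + η ⊗ₜ (ι K x * a), by simp [-ι_apply, add_mul]⟩
  · rintro n x ω ⟨t, ht⟩
    simp only [Submodule.mem_comap, AlgHom.toLinearMap_apply] at ht ⊢
    rw [map_mul, ← ht, coactR_form]
    clear ht
    induction t using TensorProduct.induction_on with
    | zero => simp
    | add s t hs ht => rw [map_add, mul_add]; exact add_mem hs ht
    | tmul η a => exact ⟨⟨_, form_mul_mem_deg x η.2⟩ ⊗ₜ a, by simp⟩

variable (P) in
/-- The bicovariant differential graded algebra of a pre-Lie structure. -/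
noncomputable def bicovariantDGA :
    BicovariantDGA K (UniversalEnvelopingAlgebra K L) P.Forms where
  __ := dga P
  coactL := coactL P
  coactR := coactR P
  coactL_incl := coactL_incl
  coactR_incl := coactR_incl
  coactL_d := coactL_d
  coactR_d := coactR_d
  coactL_deg _ _ := coactL_deg
  coactR_deg _ _ := coactR_deg
  coactL_coassoc ω := by
    have h : ((Algebra.TensorProduct.assoc K K K (UniversalEnvelopingAlgebra K L)
          (UniversalEnvelopingAlgebra K L) P.Forms).toAlgHom.comp
        (Algebra.TensorProduct.map (Bialgebra.comulAlgHom K _) (AlgHom.id K _))).comp (coactL P) =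
        (Algebra.TensorProduct.map (AlgHom.id K _) (coactL P)).comp (coactL P) := by
      refine algHom_ext (fun x => ?_) fun x => ?_
      · simp only [AlgHom.comp_apply, coactL_fn, comul_ι, map_add, Algebra.TensorProduct.map_tmul,
          map_one, AlgHom.id_apply, TensorProduct.add_tmul, TensorProduct.tmul_add,
          AlgEquiv.toAlgHom_apply, Algebra.TensorProduct.assoc_tmul,
          Algebra.TensorProduct.one_def]
        abel
      · simp only [AlgHom.comp_apply, coactL_form, Algebra.TensorProduct.map_tmul,
          map_one, AlgHom.id_apply, AlgEquiv.toAlgHom_apply, Algebra.TensorProduct.assoc_tmul,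
          Algebra.TensorProduct.one_def]
    exact DFunLike.congr_fun h ω
  coactR_coassoc ω := by
    have h : ((Algebra.TensorProduct.assoc K K K P.Forms (UniversalEnvelopingAlgebra K L)
          (UniversalEnvelopingAlgebra K L)).toAlgHom.comp
        (Algebra.TensorProduct.map (coactR P) (AlgHom.id K _))).comp (coactR P) =
        (Algebra.TensorProduct.map (AlgHom.id K _) (Bialgebra.comulAlgHom K _)).comp
          (coactR P) := by
      refine algHom_ext (fun x => ?_) fun x => ?_
      · simp only [AlgHom.comp_apply, coactR_fn, comul_ι, map_add, Algebra.TensorProduct.map_tmul,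
          map_one, AlgHom.id_apply, TensorProduct.add_tmul, TensorProduct.tmul_add,
          AlgEquiv.toAlgHom_apply, Algebra.TensorProduct.assoc_tmul,
          Algebra.TensorProduct.one_def]
        abel
      · simp only [AlgHom.comp_apply, coactR_form, Algebra.TensorProduct.map_tmul,
          map_one, AlgHom.id_apply, AlgEquiv.toAlgHom_apply, Algebra.TensorProduct.assoc_tmul,
          Algebra.TensorProduct.one_def]
    exact DFunLike.congr_fun h ω
  coactL_counit ω := by
    have h : ((Algebra.TensorProduct.lid K P.Forms).toAlgHom.comp
        (Algebra.TensorProduct.map (Bialgebra.counitAlgHom K _) (AlgHom.id K _))).comp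
          (coactL P) = AlgHom.id K _ := by
      refine algHom_ext (fun x => ?_) fun x => ?_
      · simp only [AlgHom.comp_apply, coactL_fn, counit_ι, map_add, Algebra.TensorProduct.map_tmul,
          map_one, AlgHom.id_apply, AlgEquiv.toAlgHom_apply, Algebra.TensorProduct.lid_tmul,
          zero_smul, one_smul, zero_add]
      · simp only [AlgHom.comp_apply, coactL_form, Algebra.TensorProduct.map_tmul,
          map_one, AlgHom.id_apply, AlgEquiv.toAlgHom_apply, Algebra.TensorProduct.lid_tmul,
          one_smul]
    exact DFunLike.congr_fun h ω
  coactR_counit ω := by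
    have h : ((Algebra.TensorProduct.rid K K P.Forms).toAlgHom.comp
        (Algebra.TensorProduct.map (AlgHom.id K _) (Bialgebra.counitAlgHom K _))).comp
          (coactR P) = AlgHom.id K _ := by
      refine algHom_ext (fun x => ?_) fun x => ?_
      · simp only [AlgHom.comp_apply, coactR_fn, counit_ι, map_add, Algebra.TensorProduct.map_tmul,
          map_one, AlgHom.id_apply, AlgEquiv.toAlgHom_apply, Algebra.TensorProduct.rid_tmul,
          zero_smul, one_smul, add_zero]
      · simp only [AlgHom.comp_apply, coactR_form, Algebra.TensorProduct.map_tmul,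
          map_one, AlgHom.id_apply, AlgEquiv.toAlgHom_apply, Algebra.TensorProduct.rid_tmul,
          one_smul]
    exact DFunLike.congr_fun h ω
  bicomodule ω := by
    have h : ((Algebra.TensorProduct.assoc K K K (UniversalEnvelopingAlgebra K L) P.Forms
          (UniversalEnvelopingAlgebra K L)).toAlgHom.comp
        (Algebra.TensorProduct.map (coactL P) (AlgHom.id K _))).comp (coactR P) =
        (Algebra.TensorProduct.map (AlgHom.id K _) (coactR P)).comp (coactL P) := by
      refine algHom_ext (fun x => ?_) fun x => ?_
      · simp only [AlgHom.comp_apply, coactL_fn, coactR_fn, map_add,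
          Algebra.TensorProduct.map_tmul, map_one, AlgHom.id_apply, TensorProduct.add_tmul,
          TensorProduct.tmul_add, AlgEquiv.toAlgHom_apply, Algebra.TensorProduct.assoc_tmul,
          Algebra.TensorProduct.one_def]
        abel
      · simp only [AlgHom.comp_apply, coactL_form, coactR_form, Algebra.TensorProduct.map_tmul,
          map_one, AlgEquiv.toAlgHom_apply, Algebra.TensorProduct.assoc_tmul]
    exact DFunLike.congr_fun h ω

theorem d_incl_ι (x : L) : d P (incl P (ι K x)) = form P x := by rw [incl_ι, d_fn]

theorem isStandard : (bicovariantDGA P).IsStandard := by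
  refine eq_top_iff.mpr (adjoin_eq_top.symm.le.trans (Algebra.adjoin_mono ?_))
  rintro _ (⟨x, rfl⟩ | ⟨x, rfl⟩)
  · exact Or.inl ⟨ι K x, incl_ι x⟩
  · exact Or.inr ⟨ι K x, d_incl_ι x⟩

end Coactions

end Forms

end PreLieStructure

namespace PreLieStructure

attribute [local instance 100] LieRing.ofAssociativeRing

open UniversalEnvelopingAlgebra

namespace Forms

section Representation

variable {K : Type u} [CommRing K] {L : Type v} [LieRing L] [LieAlgebra K L]
  {P : PreLieStructure K L}

/-! ### Functions and one-forms as a representation -/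

variable (P) in
/-- The action of `L` on `L ⊗ U(L)`, the right-free model of the one-forms:
`x (w ⊗ a) = (x ∘ w) ⊗ a + w ⊗ x a`. -/
noncomputable def oneFormAct : L →ₗ[K] Module.End K (L ⊗[K] UniversalEnvelopingAlgebra K L) :=
  { toFun := fun x => TensorProduct.map (P.mul x) LinearMap.id +
      TensorProduct.map LinearMap.id (LinearMap.mulLeft K (ι K x))
    map_add' := fun x y => TensorProduct.ext' fun w a => by
      simp [-ι_apply, TensorProduct.add_tmul, TensorProduct.tmul_add, add_mul]; abel
    map_smul' := fun r x => TensorProduct.ext' fun w a => by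
      simp [-ι_apply, TensorProduct.smul_tmul'] }

@[simp]
theorem oneFormAct_tmul (x w : L) (a : UniversalEnvelopingAlgebra K L) :
    oneFormAct P x (w ⊗ₜ[K] a) = P.mul x w ⊗ₜ[K] a + w ⊗ₜ[K] (ι K x * a) := rfl

theorem oneFormAct_comm (x y : L) (t : L ⊗[K] UniversalEnvelopingAlgebra K L) :
    oneFormAct P x (oneFormAct P y t) =
      oneFormAct P y (oneFormAct P x t) + oneFormAct P ⁅x, y⁆ t := by
  induction t using TensorProduct.induction_on with
  | zero => simp
  | add s t hs ht => simp only [map_add, hs, ht]; abel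
  | tmul w a =>
    have h1 : P.mul ⁅x, y⁆ w = P.mul x (P.mul y w) - P.mul y (P.mul x w) := by
      rw [P.lie_eq, map_sub, LinearMap.sub_apply, P.left_symm]
    simp only [oneFormAct_tmul, map_add, h1, LieHom.map_lie,
      LieRing.of_associative_ring_bracket, TensorProduct.sub_tmul, sub_mul, TensorProduct.tmul_sub,
      mul_assoc]
    abel

variable (P) in
/-- The representation of the algebra of forms on `U(L) ⊕ (L ⊗ U(L))`, a model of the functions and
one-forms, in which the product of two one-forms is set to zero. -/
noncomputable def rep : P.Forms →ₐ[K] Module.End K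
    (UniversalEnvelopingAlgebra K L × (L ⊗[K] UniversalEnvelopingAlgebra K L)) :=
  lift
    { toFun := fun x => LinearMap.prodMap (LinearMap.mulLeft K (ι K x)) (oneFormAct P x)
      map_add' := fun x y => LinearMap.ext fun t => by simp [-ι_apply, add_mul]
      map_smul' := fun r x => LinearMap.ext fun t => by simp [-ι_apply] }
    { toFun := fun x => LinearMap.inr K _ _ ∘ₗ TensorProduct.mk K L _ x ∘ₗ LinearMap.fst K _ _
      map_add' := fun x y => LinearMap.ext fun t => by simp
      map_smul' := fun r x => LinearMap.ext fun t => by simp [TensorProduct.smul_tmul'] }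
    (fun x y => LinearMap.ext fun t => Prod.ext
      (by simp [-ι_apply, LieRing.of_associative_ring_bracket, sub_mul, mul_assoc])
      (by simpa using oneFormAct_comm x y t.2))
    (fun x y => LinearMap.ext fun t => Prod.ext (by simp) (by simp [-ι_apply, add_comm]))
    (fun x y => LinearMap.ext fun t => Prod.ext (by simp) (by simp))

theorem rep_fn (x : L)
    (t : UniversalEnvelopingAlgebra K L × (L ⊗[K] UniversalEnvelopingAlgebra K L)) :
    rep P (fn P x) t = (ι K x * t.1, oneFormAct P x t.2) := by
  rw [rep, lift_fn]
  rfl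

theorem rep_form (x : L)
    (t : UniversalEnvelopingAlgebra K L × (L ⊗[K] UniversalEnvelopingAlgebra K L)) :
    rep P (form P x) t = (0, x ⊗ₜ t.1) := by
  rw [rep, lift_form]
  rfl

variable (P) in
/-- The one-form component of a form, as an element of `L ⊗ U(L)`. -/
noncomputable def oneForm : P.Forms →ₗ[K] L ⊗[K] UniversalEnvelopingAlgebra K L :=
  LinearMap.snd K _ _ ∘ₗ LinearMap.applyₗ (1, 0) ∘ₗ (rep P).toLinearMap

theorem oneForm_apply (ω : P.Forms) : oneForm P ω = (rep P ω (1, 0)).2 := rfl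

theorem rep_incl (a : UniversalEnvelopingAlgebra K L) : rep P (incl P a) (1, 0) = (a, 0) := by
  refine LinearMap.congr_fun (f := LinearMap.applyₗ (1, 0) ∘ₗ (rep P).toLinearMap ∘ₗ
    (incl P).toLinearMap) (g := LinearMap.inl K _ _) (linearMap_eq_of_ι_mul ?_ fun x a ih => ?_) a
  · simp
  · simp only [LinearMap.comp_apply, AlgHom.toLinearMap_apply, LinearMap.applyₗ_apply_apply,
      LinearMap.inl_apply] at ih ⊢
    rw [incl_ι_mul, map_mul, Module.End.mul_apply, ih, rep_fn, map_zero]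

theorem oneForm_form_mul_incl (x : L) (a : UniversalEnvelopingAlgebra K L) :
    oneForm P (form P x * incl P a) = x ⊗ₜ a := by
  rw [oneForm_apply, map_mul, Module.End.mul_apply, rep_incl, rep_form]

variable (P) in
/-- The differential `U(L) → L ⊗ U(L)`. -/
noncomputable def dFn :
    UniversalEnvelopingAlgebra K L →ₗ[K] L ⊗[K] UniversalEnvelopingAlgebra K L :=
  oneForm P ∘ₗ d P ∘ₗ (incl P).toLinearMap

theorem dFn_apply (a : UniversalEnvelopingAlgebra K L) :
    dFn P a = oneForm P (d P (incl P a)) := rfl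

theorem dFn_one : dFn P 1 = 0 := by simp [dFn_apply]

theorem dFn_ι_mul (x : L) (a : UniversalEnvelopingAlgebra K L) :
    dFn P (ι K x * a) = x ⊗ₜ a + oneFormAct P x (dFn P a) := by
  rw [dFn_apply, incl_ι_mul, d_fn_mul, map_add, oneForm_form_mul_incl, oneForm_apply, map_mul,
    Module.End.mul_apply, rep_fn]
  rfl

/-! ### Left-invariant one-forms -/

variable (P) in
/-- The value at the unit of the one-form component of a form: `v a ↦ ε(a) v` for `v ∈ L`. -/
noncomputable def symbol : P.Forms →ₗ[K] L :=
  (TensorProduct.rid K L).toLinearMap ∘ₗ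
    TensorProduct.map LinearMap.id (Coalgebra.counit (R := K)) ∘ₗ oneForm P

theorem symbol_form_mul_incl (x : L) (a : UniversalEnvelopingAlgebra K L) :
    symbol P (form P x * incl P a) = Coalgebra.counit (R := K) a • x := by
  simp [symbol, oneForm_form_mul_incl]

theorem symbol_form (x : L) : symbol P (form P x) = x := by
  simpa using symbol_form_mul_incl (P := P) x 1

variable (P) in
/-- The linear map `a ⊗ ω ↦ d(symbol ω) a`. -/
noncomputable def symbolMul : UniversalEnvelopingAlgebra K L ⊗[K] P.Forms →ₗ[K] P.Forms :=
  TensorProduct.lift ((LinearMap.mul K P.Forms).flip.compl₁₂ (incl P).toLinearMap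
    (form P ∘ₗ symbol P))

theorem symbolMul_tmul (a : UniversalEnvelopingAlgebra K L) (ω : P.Forms) :
    symbolMul P (a ⊗ₜ ω) = form P (symbol P ω) * incl P a := rfl

/-- A one-form is recovered from its left coaction and the symbol. -/
theorem symbolMul_coactL {ω : P.Forms} (hω : ω ∈ deg P 1) : symbolMul P (coactL P ω) = ω := by
  suffices h : Submodule.span K (Set.range fun t : L × UniversalEnvelopingAlgebra K L =>
      form P t.1 * incl P t.2) ≤
      LinearMap.eqLocus (symbolMul P ∘ₗ (coactL P).toLinearMap) LinearMap.id from
    h (deg_one_le hω)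
  rw [Submodule.span_le]
  rintro _ ⟨⟨x, a⟩, rfl⟩
  change symbolMul P (coactL P (form P x * incl P a)) = form P x * incl P a
  have h : ∀ q : UniversalEnvelopingAlgebra K L ⊗[K] UniversalEnvelopingAlgebra K L,
      symbolMul P (1 ⊗ₜ form P x * TensorProduct.map LinearMap.id (incl P).toLinearMap q) =
      form P x * incl P (TensorProduct.rid K _
        (TensorProduct.map LinearMap.id (Coalgebra.counit (R := K)) q)) := by
    intro q
    induction q using TensorProduct.induction_on with
    | zero => simp
    | add s t hs ht => simp only [map_add, mul_add, hs, ht]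
    | tmul b c => simp [symbolMul_tmul, symbol_form_mul_incl]
  rw [map_mul, coactL_form, coactL_incl, h]
  have := Coalgebra.lTensor_counit_comul (R := K) a
  rw [LinearMap.lTensor] at this
  rw [this]
  simp

theorem leftInvariantOneForms_eq :
    (bicovariantDGA P).leftInvariantOneForms = LinearMap.range (form P) := by
  apply le_antisymm
  · rintro ω ⟨h1, h2⟩
    change coactL P ω = 1 ⊗ₜ ω at h2
    refine ⟨symbol P ω, ?_⟩
    have := symbolMul_coactL h1
    rwa [h2, symbolMul_tmul, map_one, mul_one] at this
  · rintro _ ⟨x, rfl⟩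
    exact ⟨form_mem_deg x, coactL_form x⟩

/-! ### Connectedness -/

variable (K L) in
/-- The standard filtration of `U(L)`: the span of the products of at most `n` elements of `L`. -/
noncomputable def filtration : ℕ → Submodule K (UniversalEnvelopingAlgebra K L)
  | 0 => 1
  | n + 1 => filtration n ⊔
      LinearMap.range (ι K : L →ₗ⁅K⁆ UniversalEnvelopingAlgebra K L).toLinearMap * filtration n

theorem filtration_le_succ (n : ℕ) : filtration K L n ≤ filtration K L (n + 1) := le_sup_left

theorem ι_mul_mem_filtration (x : L) {n : ℕ} {a : UniversalEnvelopingAlgebra K L}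
    (h : a ∈ filtration K L n) : ι K x * a ∈ filtration K L (n + 1) :=
  Submodule.mem_sup_right (Submodule.mul_mem_mul ⟨x, rfl⟩ h)

theorem filtration_succ_le {n : ℕ} {p : Submodule K (UniversalEnvelopingAlgebra K L)}
    (h : filtration K L n ≤ p) (h' : ∀ x, ∀ a ∈ filtration K L n, ι K x * a ∈ p) :
    filtration K L (n + 1) ≤ p := by
  refine sup_le h (Submodule.mul_le.mpr ?_)
  rintro _ ⟨x, rfl⟩ a ha
  exact h' x a ha

theorem exists_mem_filtration (a : UniversalEnvelopingAlgebra K L) :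
    ∃ n, a ∈ filtration K L n := by
  have hmono : Monotone (filtration K L) := monotone_nat_of_le_succ filtration_le_succ
  have : ⨆ n, filtration K L n = ⊤ := by
    refine Submodule.eq_top_of_mul_mem adjoin_range_ι _
      (Submodule.mem_iSup_of_mem 0 (Submodule.mem_one.mpr ⟨1, map_one _⟩)) ?_
    rintro _ ⟨x, rfl⟩ a ha
    rw [Submodule.mem_iSup_of_directed _ hmono.directed_le] at ha
    obtain ⟨n, hn⟩ := ha
    exact Submodule.mem_iSup_of_mem (n + 1) (ι_mul_mem_filtration x hn)
  rw [← Submodule.mem_iSup_of_directed _ hmono.directed_le, this]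
  exact Submodule.mem_top

variable (K L) in
/-- The filtration shifted by one: `0` for `n = 0`, and the products of at most `n - 1` elements of
`L` for `n > 0`. -/
noncomputable def filtrationPred : ℕ → Submodule K (UniversalEnvelopingAlgebra K L)
  | 0 => ⊥
  | n + 1 => filtration K L n

theorem filtrationPred_le (n : ℕ) : filtrationPred K L n ≤ filtration K L n := by
  cases n with
  | zero => exact bot_le
  | succ n => exact filtration_le_succ n

theorem ι_mul_mem_of_filtrationPred (x : L) {n : ℕ} {a : UniversalEnvelopingAlgebra K L}
    (h : a ∈ filtrationPred K L n) : ι K x * a ∈ filtration K L n := by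
  cases n with
  | zero =>
    rw [(Submodule.mem_bot K).mp h, mul_zero]
    exact zero_mem _
  | succ n => exact ι_mul_mem_filtration x h

variable (K L) in
/-- The one-forms `v a` with `v ∈ L` and `a` a combination of products of less than `n` elements
of `L`. -/
noncomputable def oneFormFiltration (n : ℕ) : Submodule K (L ⊗[K] UniversalEnvelopingAlgebra K L) :=
  LinearMap.range (TensorProduct.map LinearMap.id (filtrationPred K L n).subtype)

theorem tmul_mem_oneFormFiltration (x : L) {n : ℕ} {a : UniversalEnvelopingAlgebra K L}
    (h : a ∈ filtrationPred K L n) : x ⊗ₜ a ∈ oneFormFiltration K L n :=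
  ⟨x ⊗ₜ ⟨a, h⟩, rfl⟩

theorem oneFormFiltration_le_succ (n : ℕ) :
    oneFormFiltration K L n ≤ oneFormFiltration K L (n + 1) := by
  rintro _ ⟨t, rfl⟩
  induction t using TensorProduct.induction_on with
  | zero => simp
  | add s t hs ht => rw [map_add]; exact add_mem hs ht
  | tmul w a => exact tmul_mem_oneFormFiltration w (filtrationPred_le n a.2)

variable (K L) in
/-- The contraction `v a ↦ v a` from `L ⊗ U(L)` to `U(L)`; on symbols, the contraction of one-forms
with the Euler vector field. -/
noncomputable def contract : L ⊗[K] UniversalEnvelopingAlgebra K L →ₗ[K]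
    UniversalEnvelopingAlgebra K L :=
  TensorProduct.lift (LinearMap.mul K _ ∘ₗ
    (ι K : L →ₗ⁅K⁆ UniversalEnvelopingAlgebra K L).toLinearMap)

theorem contract_tmul (x : L) (a : UniversalEnvelopingAlgebra K L) :
    contract K L (x ⊗ₜ a) = ι K x * a := rfl

theorem oneFormAct_mem (x : L) {n : ℕ} {t : L ⊗[K] UniversalEnvelopingAlgebra K L}
    (h : t ∈ oneFormFiltration K L n) : oneFormAct P x t ∈ oneFormFiltration K L (n + 1) := by
  obtain ⟨t, rfl⟩ := h
  induction t using TensorProduct.induction_on with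
  | zero => simp
  | add s t hs ht => rw [map_add, map_add]; exact add_mem hs ht
  | tmul w a =>
    exact (oneFormFiltration K L (n + 1)).add_mem
      (tmul_mem_oneFormFiltration _ (filtrationPred_le n a.2))
      (tmul_mem_oneFormFiltration w (ι_mul_mem_of_filtrationPred x a.2))

/-- The contraction commutes with the action of `L` up to terms of lower order. -/
theorem contract_oneFormAct (x : L) {n : ℕ} {t : L ⊗[K] UniversalEnvelopingAlgebra K L}
    (h : t ∈ oneFormFiltration K L n) :
    contract K L (oneFormAct P x t) - ι K x * contract K L t ∈ filtration K L n := by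
  obtain ⟨t, rfl⟩ := h
  induction t using TensorProduct.induction_on with
  | zero => simp
  | add s t hs ht =>
    simp only [map_add, mul_add]
    rw [add_sub_add_comm]
    exact add_mem hs ht
  | tmul w a =>
    have h : contract K L (oneFormAct P x (w ⊗ₜ (a : UniversalEnvelopingAlgebra K L))) -
        ι K x * contract K L (w ⊗ₜ (a : UniversalEnvelopingAlgebra K L)) =
        ι K (P.mul w x) * a := by
      have hl : ι K (P.mul w x) = ι K (P.mul x w) - (ι K x * ι K w - ι K w * ι K x) := by
        rw [← LieRing.of_associative_ring_bracket, ← LieHom.map_lie, P.lie_eq x w, map_sub]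
        abel
      rw [oneFormAct_tmul, map_add, contract_tmul, contract_tmul, contract_tmul, hl]
      noncomm_ring
    exact h ▸ ι_mul_mem_of_filtrationPred _ a.2

/-- On elements of order `n`, contraction after the differential is multiplication by `n` up to
terms of lower order. -/
theorem contract_dFn {n : ℕ} {a : UniversalEnvelopingAlgebra K L} (h : a ∈ filtration K L n) :
    dFn P a ∈ oneFormFiltration K L n ∧
      contract K L (dFn P a) - (n : K) • a ∈ filtrationPred K L n := by
  suffices h : filtration K L n ≤ (oneFormFiltration K L n).comap (dFn P) ⊓
      (filtrationPred K L n).comap (contract K L ∘ₗ dFn P - (n : K) • LinearMap.id) from h ‹_›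
  clear h a
  induction n with
  | zero =>
    rw [filtration, Submodule.one_le]
    simp [dFn_one]
  | succ n ih =>
    refine filtration_succ_le (fun a ha => ?_) fun x a ha => ?_
    · obtain ⟨h1, h2⟩ := ih ha
      refine ⟨oneFormFiltration_le_succ n h1, ?_⟩
      change contract K L (dFn P a) - ((n + 1 : ℕ) : K) • a ∈ filtration K L n
      have h2' : contract K L (dFn P a) - (n : K) • a ∈ filtrationPred K L n := h2
      have : contract K L (dFn P a) - ((n + 1 : ℕ) : K) • a =
          (contract K L (dFn P a) - (n : K) • a) - a := by
        push_cast; rw [add_smul, one_smul]; abel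
      exact this ▸ sub_mem (filtrationPred_le n h2') ha
    · obtain ⟨h1, h2⟩ := ih ha
      have h2' : contract K L (dFn P a) - (n : K) • a ∈ filtrationPred K L n := h2
      refine ⟨?_, ?_⟩
      · change dFn P (ι K x * a) ∈ oneFormFiltration K L (n + 1)
        rw [dFn_ι_mul]
        exact add_mem (tmul_mem_oneFormFiltration _ ha) (oneFormAct_mem x h1)
      · change contract K L (dFn P (ι K x * a)) - ((n + 1 : ℕ) : K) • (ι K x * a) ∈
          filtration K L n
        have : contract K L (dFn P (ι K x * a)) - ((n + 1 : ℕ) : K) • (ι K x * a) =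
            (contract K L (oneFormAct P x (dFn P a)) - ι K x * contract K L (dFn P a)) +
              ι K x * (contract K L (dFn P a) - (n : K) • a) := by
          rw [dFn_ι_mul, map_add, contract_tmul, mul_sub, mul_smul_comm]
          push_cast; rw [add_smul, one_smul]; abel
        exact this ▸ add_mem (contract_oneFormAct x h1) (ι_mul_mem_of_filtrationPred x h2')

end Representation

section Field

variable {K : Type u} [Field K] {L : Type v} [LieRing L] [LieAlgebra K L] {P : PreLieStructure K L}

theorem satisfiesPreLieRelations :
    SatisfiesPreLieRelations (bicovariantDGA P).toDiffGradedAlgebra P := by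
  intro x y
  change incl P (ι K x) * d P (incl P (ι K y)) - d P (incl P (ι K y)) * incl P (ι K x) =
    d P (incl P (ι K (P.mul x y)))
  rw [d_incl_ι, d_incl_ι, incl_ι, fn_mul_form, add_sub_cancel_left]

/-- If `da = 0` for `a` of order `n > 0`, then `n a` is of lower order, and so is `a`. -/
theorem isConnected [CharZero K] : (bicovariantDGA P).IsConnected := by
  intro a
  constructor
  · intro h
    have h0 : dFn P a = 0 := by
      change oneForm P (d P (incl P a)) = 0
      rw [show d P (incl P a) = 0 from h, map_zero]
    obtain ⟨n, hn⟩ := exists_mem_filtration a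
    induction n with
    | zero =>
      obtain ⟨r, hr⟩ := Submodule.mem_one.mp hn
      exact ⟨r, hr.symm⟩
    | succ n ih =>
      have := (contract_dFn (P := P) hn).2
      rw [h0, map_zero, zero_sub, neg_mem_iff] at this
      exact ih ((Submodule.smul_mem_iff _ (Nat.cast_ne_zero.mpr n.succ_ne_zero)).mp this)
  · rintro ⟨r, rfl⟩
    change d P (incl P (algebraMap K _ r)) = 0
    rw [AlgHom.commutes, Algebra.algebraMap_eq_smul_one, map_smul, d_one, smul_zero]

theorem isConnectedClassical [CharZero K] [FiniteDimensional K L] :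
    IsConnectedClassical (bicovariantDGA P) := by
  have hinj : Function.Injective (form P) := Function.LeftInverse.injective symbol_form
  refine ⟨isConnected, ?_, ?_⟩
  · rw [leftInvariantOneForms_eq]
    infer_instance
  · rw [leftInvariantOneForms_eq, LinearMap.finrank_range_of_inj hinj]

end Field

end Forms

end PreLieStructure

/-! ### Equivalence of calculi and pre-Lie structures -/

theorem mainTheorem4 {K : Type u} [Field K] [CharZero K] {L : Type v} [LieRing L]
    [LieAlgebra K L] [FiniteDimensional K L] :
    List.TFAE [
      ∃ (Ω : Type (max u v)) (_ : Ring Ω) (_ : Algebra K Ω)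
        (C : BicovariantDGA K (UniversalEnvelopingAlgebra K L) Ω), IsConnectedClassical C,
      ∃ (Ω : Type (max u v)) (_ : Ring Ω) (_ : Algebra K Ω)
        (C : BicovariantDGA K (UniversalEnvelopingAlgebra K L) Ω),
        IsConnectedClassical C ∧ C.IsStandard,
      Nonempty (PreLieStructure K L)] ∧
    (∀ P : PreLieStructure K L,
      ∃ (Ω : Type (max u v)) (_ : Ring Ω) (_ : Algebra K Ω)
        (C : BicovariantDGA K (UniversalEnvelopingAlgebra K L) Ω),
        IsConnectedClassical C ∧ C.IsStandard ∧
          SatisfiesPreLieRelations C.toDiffGradedAlgebra P) ∧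
    (∀ (Ω : Type w) [Ring Ω] [Algebra K Ω]
        (C : BicovariantDGA K (UniversalEnvelopingAlgebra K L) Ω), IsConnectedClassical C →
      (Function.Injective C.formMap ∧ LinearMap.range C.formMap = C.deg 1) ∧
      ∃! P : PreLieStructure K L, SatisfiesPreLieRelations C.toDiffGradedAlgebra P) := by
  have existence : ∀ P : PreLieStructure K L,
      ∃ (Ω : Type (max u v)) (_ : Ring Ω) (_ : Algebra K Ω)
        (C : BicovariantDGA K (UniversalEnvelopingAlgebra K L) Ω),
        IsConnectedClassical C ∧ C.IsStandard ∧
          SatisfiesPreLieRelations C.toDiffGradedAlgebra P := fun P =>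
    ⟨P.Forms, inferInstance, inferInstance, PreLieStructure.Forms.bicovariantDGA P,
      PreLieStructure.Forms.isConnectedClassical, PreLieStructure.Forms.isStandard,
      PreLieStructure.Forms.satisfiesPreLieRelations⟩
  refine ⟨?_, existence, fun Ω _ _ C hC => ⟨⟨BicovariantDGA.formMap_injective hC.1,
    BicovariantDGA.range_formMap hC⟩, BicovariantDGA.existsUnique_preLieStructure hC⟩⟩
  tfae_have 2 → 1 := fun ⟨Ω, i, j, C, h⟩ => ⟨Ω, i, j, C, h.1⟩
  tfae_have 1 → 3 := fun ⟨_, _, _, _, h⟩ =>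
    (BicovariantDGA.existsUnique_preLieStructure h).exists.nonempty
  tfae_have 3 → 2 := fun ⟨P⟩ =>
    let ⟨Ω, i, j, C, h⟩ := existence P
    ⟨Ω, i, j, C, h.1, h.2.1⟩
  tfae_finish
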